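/- A boolean cellular automaton $B=\langle D,F,x\rangle$ with $n$ gates $1,\dots,n$ consists of a digraph $D$ in which every gate $i$ has exactly two distinct inputs (in-neighbours) $j_i<k_i$ (a gate may be its own input), boolean functions $F=(f_1,\dots,f_n)$ with $f_i:\{0,1\}^2\to\{0,1\}$, and an initial state $x\in\{0,1\}^n$. Its state at time $0$ is $x$, and a state $y$ is followed by the state $B(y)=(f_1(y_{j_1},y_{k_1}),\dots,f_n(y_{j_n},y_{k_n}))$. Let $B^t(x)$ be the state at time $t$, let $t_1$ be the first time at which an earlier state recurs, and let $t_0<t_1$ satisfy $B^{t_0}(x)=B^{t_1}(x)$; the state cycle of $B$ is the set $\{B^t(x):t\ge t_0\}$. A function $f:\{0,1\}^2\to\{0,1\}$ is canalyzing if for one of its two arguments there are values $u,v\in\{0,1\}$ such that $f$ takes the value $v$ whenever that argument is $u$. Let $\mathcal A$ be the set of the two constant functions, $\mathcal B_1$ (respectively $\mathcal B_2$) the set of the canalyzing functions that depend on exactly one argument (respectively on both arguments), and $\mathcal C$ the set of the two non-canalyzing functions (equivalence and exclusive or). Fix probabilities $a_f\ge 0$ for $f:\{0,1\}^2\to\{0,1\}$,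 with $\sum_f a_f=1$, that satisfy the symmetry conditions $$a_{f(x,y)}=a_{f(y,x)}\ (f\in\mathcal B_1),\qquad a_{f(x,y)}=a_{f(\neg x,\neg y)}\ (f\in\mathcal B_2),\qquad a_{f(x,y)}=a_{\neg f(x,y)}\ (f\in\mathcal C).$$ Put $a=\sum_{f\in\mathcal A}a_f$ and $c=\sum_{f\in\mathcal C}a_f$. In the random boolean cellular automaton on $n$ gates, all choices are independent: for each gate the pair of inputs is uniform among the $\binom n2$ pairs of gates, its function is $f$ with probability $a_f$, and the initial state is uniform on $\{0,1\}^n$. Let $\mathbf C$ be the size of the state cycle of this random automaton. **Theorem.** If $a=c\neq 0$, then for every real constant $\gamma$ and all sufficiently large $n$ (depending on $\gamma$ and on the distribution $\langle a_f\rangle$), $$\mathbf E(\mathbf C)>n^{\gamma}.$$ -/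

import Mathlib

open Filter
open scoped BigOperators

namespace RBCA

/-- Boolean functions of two arguments. -/
abbrev BoolFn : Type := Bool → Bool → Bool

namespace BoolFn

/-- `f` depends on its first argument. -/
abbrev DependsFst (f : BoolFn) : Prop := ∃ v : Bool, f false v ≠ f true v

/-- `f` depends on its second argument. -/
abbrev DependsSnd (f : BoolFn) : Prop := ∃ v : Bool, f v false ≠ f v true

/-- `f` is canalyzing: some argument has a forcing value `u` with a forced value `v`. -/
abbrev Canalyzing (f : BoolFn) : Prop :=
  (∃ u v : Bool, ∀ x y : Bool, x = u → f x y = v) ∨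
  (∃ u v : Bool, ∀ x y : Bool, y = u → f x y = v)

/-- The class `𝒜`: the constant functions. -/
abbrev ClassA (f : BoolFn) : Prop := ∃ v : Bool, ∀ x y : Bool, f x y = v

/-- The class `ℬ₁`: the canalyzing functions that depend on exactly one argument. -/
abbrev ClassB1 (f : BoolFn) : Prop :=
  f.Canalyzing ∧ ((f.DependsFst ∧ ¬ f.DependsSnd) ∨ (f.DependsSnd ∧ ¬ f.DependsFst))

/-- The class `ℬ₂`: the canalyzing functions that depend on both arguments. -/
abbrev ClassB2 (f : BoolFn) : Prop := f.Canalyzing ∧ f.DependsFst ∧ f.DependsSnd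

/-- The class `𝒞`: the non-canalyzing functions. -/
abbrev ClassC (f : BoolFn) : Prop := ¬ f.Canalyzing

end BoolFn

/-- `p` is a probability distribution on the sixteen boolean functions of two arguments. -/
structure IsDistribution (p : BoolFn → ℝ) : Prop where
  nonneg : ∀ f, 0 ≤ p f
  sum_eq_one : ∑ f, p f = 1

/-- The symmetry conditions on the distribution `p`. -/
structure IsSymmetric (p : BoolFn → ℝ) : Prop where
  swap_args : ∀ f : BoolFn, f.ClassB1 → p f = p (fun x y => f y x)
  neg_args : ∀ f : BoolFn, f.ClassB2 → p f = p (fun x y => f (!x) (!y))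
  neg_value : ∀ f : BoolFn, f.ClassC → p f = p (fun x y => !(f x y))

/-- The probability `a` that a gate is assigned a constant function. -/
def probConstant (p : BoolFn → ℝ) : ℝ := ∑ f : BoolFn with f.ClassA, p f

/-- The probability `c` that a gate is assigned a non-canalyzing function. -/
def probNonCanalyzing (p : BoolFn → ℝ) : ℝ := ∑ f : BoolFn with f.ClassC, p f

/-- The possible pairs of inputs `j < k` of a gate; there are `n.choose 2` of them. -/
abbrev InputPair (n : ℕ) : Type := {q : Fin n × Fin n // q.1 < q.2}

/-- A boolean cellular automaton with `n` gates: a digraph in which every gate has indegree two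
(given by the two in-neighbours of each gate), a boolean function for each gate, and an
initial state. A gate may be one of its own inputs. -/
structure Automaton (n : ℕ) where
  inputs : Fin n → InputPair n
  fn : Fin n → BoolFn
  init : Fin n → Bool

namespace Automaton

variable {n : ℕ}

/-- The transition function: all gates are updated simultaneously. -/
def step (B : Automaton n) (y : Fin n → Bool) : Fin n → Bool :=
  fun i => B.fn i (y (B.inputs i).1.1) (y (B.inputs i).1.2)

/-- The state at time `t`, starting from the initial state. -/
def state (B : Automaton n) (t : ℕ) : Fin n → Bool := B.step^[t] B.init

theorem exists_repeat (B : Automaton n) : ∃ t₁ t₀ : ℕ, t₀ < t₁ ∧ B.state t₀ = B.state t₁ := by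
  obtain ⟨s, t, hne, h⟩ := Finite.exists_ne_map_eq_of_infinite B.state
  rcases lt_or_gt_of_ne hne with hlt | hlt
  · exact ⟨t, s, hlt, h⟩
  · exact ⟨s, t, hlt, h.symm⟩

open Classical in
/-- The first time `t₁` at which an earlier state recurs. -/
noncomputable def firstRepeat (B : Automaton n) : ℕ := Nat.find B.exists_repeat

theorem exists_entry (B : Automaton n) :
    ∃ t₀ : ℕ, t₀ < B.firstRepeat ∧ B.state t₀ = B.state B.firstRepeat := by
  classical
  exact Nat.find_spec B.exists_repeat

open Classical in
/-- The time `t₀ < t₁` (it is unique) whose state recurs at time `t₁`. -/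
noncomputable def cycleEntry (B : Automaton n) : ℕ := Nat.find B.exists_entry

/-- The state cycle: the set of the states at all times `t ≥ t₀`. -/
def stateCycle (B : Automaton n) : Set (Fin n → Bool) :=
  {y | ∃ t : ℕ, B.cycleEntry ≤ t ∧ B.state t = y}

/-- The size of the state cycle. -/
noncomputable def cycleSize (B : Automaton n) : ℕ := B.stateCycle.ncard

end Automaton

/-- The probability of the automaton `B` in the random model with function distribution `p`:
independently, each gate gets one of the `n.choose 2` input pairs uniformly and a boolean function
with distribution `p`, and the initial state is uniform on the `2 ^ n` states. -/
noncomputable def prob (p : BoolFn → ℝ) {n : ℕ} (B : Automaton n) : ℝ :=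
  (∏ _i : Fin n, (1 : ℝ) / (n.choose 2 : ℝ)) * (∏ i : Fin n, p (B.fn i)) * (1 / 2 ^ n)

/-- The expectation of a random variable `X` over the random automaton with `n` gates: the sum over
all automata with `n` gates, weighted by their probabilities. -/
noncomputable def expectation (p : BoolFn → ℝ) (n : ℕ) (X : Automaton n → ℝ) : ℝ :=
  ∑ D : Fin n → InputPair n, ∑ F : Fin n → BoolFn, ∑ x : Fin n → Bool,
    prob p ⟨D, F, x⟩ * X ⟨D, F, x⟩

end RBCA

/-! Simulate the automaton in three-valued logic with no gate known at the start. One step turns an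
undetermined fraction u into about u - c u² in expectation: the condition a = c removes the linear
drift, and c > 0 makes the fraction decay like 1/(ct) (`unkFrac_unknown_le`). With L about n^(1/5),
after L steps all but an expected fraction O(1/L) of the gates are settled.

Consider k disjoint cycles of gates, of distinct prime lengths between L and 8L, in which each gate
copies or negates its predecessor because its other input is settled. Given the settled gates, a
gate is wired like this with probability about 1/n. There are about n^m placements of the m = O(L)
gates, and (1 - O(1/L))^m is bounded below, so the expected number of such families is at least a
positive constant (`le_ex_wired_settled`). Two cycles of this kind that share a gate coincide, so
the second moment is O(L^k) (`ex_sq_fed_le`), and a family exists with probability at least a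
constant times L^(-k) (`le_ex_exists_rotating`).

Asking for a non-canalyzing function at one gate of each cycle costs a constant factor. Negating
that function preserves the measure and toggles the degeneracy of the orbit (`rotate_flip`); a
nondegenerate orbit forces the odd prime length to divide the size C of the state cycle
(`Automaton.dvd_cycleSize`).

If j of the primes divide C, then C ≥ (L+1)^j ≥ choose(j,k) L^k (`choose_mul_le_cycleSize`). In
expectation L^k cancels the probability L^(-k), so each k-set of primes contributes a constant.
There are at least √L primes, whence E(C) is at least a constant times L^(k/2), with k arbitrary. -/

namespace RBCA

/-! ### Masses of classes of boolean functions -/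

namespace BoolFn

/-- An involution on boolean functions under which a symmetric distribution is invariant. -/
def mirror (f : BoolFn) : BoolFn :=
  if f.ClassB1 then fun x y => f y x else if f.ClassB2 then fun x y => f (!x) (!y) else f

/-- The negation of a non-canalyzing function; the other functions are left unchanged. -/
def negC (f : BoolFn) : BoolFn := if f.ClassC then fun x y => !(f x y) else f

theorem mirror_mirror : ∀ f : BoolFn, f.mirror.mirror = f := by decide +revert

theorem negC_negC : ∀ f : BoolFn, f.negC.negC = f := by decide +revert

theorem classC_negC : ∀ f : BoolFn, f.negC.ClassC ↔ f.ClassC := by decide +revert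

theorem negC_apply {f : BoolFn} (h : f.ClassC) (a b : Bool) : f.negC a b = !(f a b) := by
  simp only [negC, if_pos h]

end BoolFn

variable {p : BoolFn → ℝ}

theorem IsSymmetric.mirror (hs : IsSymmetric p) (f : BoolFn) : p f.mirror = p f := by
  unfold BoolFn.mirror
  split_ifs with h1 h2
  · exact (hs.swap_args f h1).symm
  · exact (hs.neg_args f h2).symm
  · rfl

theorem IsSymmetric.negC (hs : IsSymmetric p) (f : BoolFn) : p f.negC = p f := by
  unfold BoolFn.negC
  split_ifs with h1
  · exact (hs.neg_value f h1).symm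
  · rfl

theorem IsSymmetric.two_mul_sum_ite (hs : IsSymmetric p) (P : BoolFn → Prop) [DecidablePred P] :
    2 * ∑ f : BoolFn, p f * (if P f then 1 else 0) =
      ∑ f : BoolFn, p f * ((if P f then 1 else 0) + (if P f.mirror then 1 else 0)) := by
  have h : ∑ f : BoolFn, p f * (if P f then (1 : ℝ) else 0) =
      ∑ f : BoolFn, p f * (if P f.mirror then 1 else 0) := by
    rw [← Equiv.sum_comp ⟨BoolFn.mirror, BoolFn.mirror, BoolFn.mirror_mirror,
      BoolFn.mirror_mirror⟩]
    refine Finset.sum_congr rfl fun f _ => ?_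
    simp only [Equiv.coe_fn_mk, hs.mirror]
  rw [two_mul]
  nth_rw 2 [h]
  rw [← Finset.sum_add_distrib]
  exact Finset.sum_congr rfl fun f _ => by ring

/-- The balance a = c enters here. By `hP`, exactly one of `f` and its mirror image satisfies `P` in
the classes ℬ₁ and ℬ₂, none does for constants, and both do for non-canalyzing functions; the last
two deviations cancel. -/
theorem half_of_count (hp : IsDistribution p) (hs : IsSymmetric p)
    (hac : probConstant p = probNonCanalyzing p) (P : BoolFn → Prop) [DecidablePred P]
    (hP : ∀ f : BoolFn, (if P f then 1 else 0) + (if P f.mirror then 1 else 0) +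
      (if f.ClassA then 1 else 0) = 1 + (if f.ClassC then 1 else 0)) :
    ∑ f : BoolFn, p f * (if P f then 1 else 0) = 1 / 2 := by
  have h := hs.two_mul_sum_ite P
  have hA : probConstant p = ∑ f : BoolFn, p f * (if f.ClassA then 1 else 0) := by
    simp [probConstant, Finset.sum_filter]
  have hC : probNonCanalyzing p = ∑ f : BoolFn, p f * (if f.ClassC then 1 else 0) := by
    simp [probNonCanalyzing, Finset.sum_filter]
  have h1 : ∑ f : BoolFn, p f * ((if P f then 1 else 0) + (if P f.mirror then 1 else 0)) +
      probConstant p = 1 + probNonCanalyzing p := by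
    have h3 : 1 + probNonCanalyzing p =
        ∑ f : BoolFn, (p f + p f * (if f.ClassC then 1 else 0)) := by
      rw [hC, Finset.sum_add_distrib, hp.sum_eq_one]
    rw [h3, hA, ← Finset.sum_add_distrib]
    refine Finset.sum_congr rfl fun f _ => ?_
    have := hP f
    have h2 : (if P f then (1 : ℝ) else 0) + (if P f.mirror then 1 else 0) +
      (if f.ClassA then 1 else 0) = 1 + (if f.ClassC then 1 else 0) := by exact_mod_cast this
    linear_combination p f * h2
  linarith

/-- Swapping arguments moves the dependence of a ℬ₁ function to its other argument; negating both
arguments of a ℬ₂ function exchanges the values `w` at which it is sensitive. -/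
theorem mass_fst (hp : IsDistribution p) (hs : IsSymmetric p)
    (hac : probConstant p = probNonCanalyzing p) (w : Bool) :
    ∑ f : BoolFn, p f * (if f false w ≠ f true w then 1 else 0) = 1 / 2 := by
  refine half_of_count hp hs hac _ ?_
  revert w; decide

theorem mass_snd (hp : IsDistribution p) (hs : IsSymmetric p)
    (hac : probConstant p = probNonCanalyzing p) (w : Bool) :
    ∑ f : BoolFn, p f * (if f w false ≠ f w true then 1 else 0) = 1 / 2 := by
  refine half_of_count hp hs hac _ ?_
  revert w; decide

theorem classC_sens : ∀ f : BoolFn, f.ClassC → ∀ w : Bool,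
    f false w ≠ f true w ∧ f w false ≠ f w true := by
  decide

theorem sum_classC (p : BoolFn → ℝ) :
    ∑ f : BoolFn, p f * (if f.ClassC then 1 else 0) = probNonCanalyzing p := by
  simp [probNonCanalyzing, Finset.sum_filter]

theorem sum_classA (p : BoolFn → ℝ) :
    ∑ f : BoolFn, p f * (if f.ClassA then 1 else 0) = probConstant p := by
  simp [probConstant, Finset.sum_filter]

theorem not_classA_and_classC : ∀ f : BoolFn, ¬ (f.ClassA ∧ f.ClassC) := by decide

theorem probNonCanalyzing_nonneg (hp : IsDistribution p) : 0 ≤ probNonCanalyzing p :=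
  Finset.sum_nonneg fun f _ => hp.nonneg f

theorem probNonCanalyzing_le_half (hp : IsDistribution p)
    (hac : probConstant p = probNonCanalyzing p) : probNonCanalyzing p ≤ 1 / 2 := by
  have h : probConstant p + probNonCanalyzing p ≤ 1 := by
    refine le_trans ?_ hp.sum_eq_one.le
    rw [← sum_classA, ← sum_classC, ← Finset.sum_add_distrib]
    refine Finset.sum_le_sum fun f _ => ?_
    have := not_classA_and_classC f
    have h0 := hp.nonneg f
    by_cases hA : f.ClassA
    · have hC : ¬ f.ClassC := fun h => this ⟨hA, h⟩
      rw [if_pos hA, if_neg hC]; linarith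
    · rw [if_neg hA]
      split_ifs <;> linarith
  linarith

/-! ### Three-valued evaluation -/

/-- The value of `f` at partially known arguments, if it is determined by them. -/
def keval (f : BoolFn) : Option Bool → Option Bool → Option Bool
  | some x, some y => some (f x y)
  | none, some y => if f false y = f true y then some (f true y) else none
  | some x, none => if f x false = f x true then some (f x true) else none
  | none, none => if f.ClassA then some (f true true) else none

/-- `a` carries at most the information of `b`. -/
def InfoLE (a b : Option Bool) : Prop := ∀ v, a = some v → b = some v

instance : ∀ a b, Decidable (InfoLE a b) := fun a b => by unfold InfoLE; infer_instance

theorem InfoLE.refl (a : Option Bool) : InfoLE a a := fun _ h => h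

theorem InfoLE.trans {a b c : Option Bool} (h : InfoLE a b) (h' : InfoLE b c) : InfoLE a c :=
  fun v hv => h' v (h v hv)

theorem infoLE_none (b : Option Bool) : InfoLE none b := fun _ h => by simp at h

theorem InfoLE.eq_none {a b : Option Bool} (h : InfoLE a b) (hb : b = none) : a = none := by
  cases a with
  | none => rfl
  | some v => have := h v rfl; simp [hb] at this

theorem keval_mono (f : BoolFn) {a b a' b' : Option Bool} (ha : InfoLE a a') (hb : InfoLE b b') :
    InfoLE (keval f a b) (keval f a' b') := by
  revert f a b a' b'; decide

theorem keval_sound (f : BoolFn) {a b : Option Bool} {x y v : Bool} (ha : InfoLE a (some x))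
    (hb : InfoLE b (some y)) (h : keval f a b = some v) : f x y = v := by
  have := keval_mono f ha hb v h
  simpa [keval] using this

/-- The probability that the value of a random function is not determined. -/
theorem mass_keval_none (hp : IsDistribution p) (hs : IsSymmetric p)
    (hac : probConstant p = probNonCanalyzing p) (a b : Option Bool) :
    ∑ f : BoolFn, p f * (if keval f a b = none then 1 else 0) =
      ((if a = none then 1 else 0) + (if b = none then 1 else 0)) / 2 -
        probNonCanalyzing p * ((if a = none then 1 else 0) * (if b = none then 1 else 0)) := by
  cases a with
  | none =>
    cases b with
    | none =>
      have h : ∀ f : BoolFn, p f * (if keval f none none = none then (1 : ℝ) else 0) =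
          p f - p f * (if f.ClassA then 1 else 0) := by
        intro f
        by_cases hA : f.ClassA
        · simp only [keval, if_pos hA]; simp
        · simp only [keval, if_neg hA]; simp
      simp_rw [h]
      -- The value 1 - a is written as 1 - c, so that one formula bilinear in the two indicators
      -- covers all cases.
      rw [Finset.sum_sub_distrib, hp.sum_eq_one, sum_classA, hac]
      simp
    | some w =>
      have h := mass_fst hp hs hac w
      simp only [keval]
      simp only [reduceCtorEq, if_true, if_false]
      rw [add_zero, mul_zero, mul_zero, sub_zero, ← h]
      refine Finset.sum_congr rfl fun f _ => ?_
      by_cases hw : f false w = f true w <;> simp [hw]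
  | some w =>
    cases b with
    | none =>
      have h := mass_snd hp hs hac w
      simp only [keval]
      simp only [reduceCtorEq, if_true, if_false]
      rw [zero_add, zero_mul, mul_zero, sub_zero, ← h]
      refine Finset.sum_congr rfl fun f _ => ?_
      by_cases hw : f w false = f w true <;> simp [hw]
    | some v => simp [keval]

/-! ### Sums over pairs of inputs -/

/-- Symmetrizing the summand replaces the order `j < k` by the condition that the two inputs differ.
-/
theorem sum_inputPair {n : ℕ} (g : Fin n → Fin n → ℝ) :
    ∑ q : InputPair n, (g q.1.1 q.1.2 + g q.1.2 q.1.1) =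
      ∑ j, ∑ k, if j = k then 0 else g j k := by
  have h1 : ∀ h : Fin n × Fin n → ℝ,
      ∑ q : InputPair n, h q.1 = ∑ j, ∑ k, if j < k then h (j, k) else 0 := by
    intro h
    rw [← Finset.sum_product', ← Finset.sum_filter]
    exact (Finset.sum_subtype (Finset.univ.filter fun q : Fin n × Fin n => q.1 < q.2)
      (by simp) h).symm
  rw [Finset.sum_add_distrib, h1 (fun q => g q.1 q.2), h1 (fun q => g q.2 q.1)]
  nth_rw 2 [Finset.sum_comm]
  rw [← Finset.sum_add_distrib]
  refine Finset.sum_congr rfl fun j _ => ?_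
  rw [← Finset.sum_add_distrib]
  refine Finset.sum_congr rfl fun k _ => ?_
  rcases lt_trichotomy j k with h | h | h
  · simp [h, h.ne, h.le, not_lt]
  · simp [h]
  · simp [h, h.ne', h.le, not_lt]

theorem sum_inputPair_add {n : ℕ} (u : Fin n → ℝ) :
    ∑ q : InputPair n, (u q.1.1 + u q.1.2) = (n - 1) * ∑ j, u j := by
  have := sum_inputPair fun j _ => u j
  rw [this, Finset.mul_sum]
  refine Finset.sum_congr rfl fun j _ => ?_
  have : ∀ k, (if j = k then (0 : ℝ) else u j) = u j - (if j = k then u j else 0) := by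
    intro k; split_ifs <;> simp
  simp_rw [this]
  rw [Finset.sum_sub_distrib]
  simp
  ring

theorem sum_inputPair_mul {n : ℕ} (u : Fin n → ℝ) :
    ∑ q : InputPair n, u q.1.1 * u q.1.2 = ((∑ j, u j) ^ 2 - ∑ j, u j ^ 2) / 2 := by
  have h := sum_inputPair fun j k => u j * u k / 2
  have h2 : ∑ q : InputPair n, u q.1.1 * u q.1.2 =
      ∑ q : InputPair n, (u q.1.1 * u q.1.2 / 2 + u q.1.2 * u q.1.1 / 2) :=
    Finset.sum_congr rfl fun q _ => by ring
  rw [h2, h]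
  have : ∀ j k, (if j = k then (0 : ℝ) else u j * u k / 2) =
      u j * u k / 2 - (if j = k then u j * u k / 2 else 0) := by
    intro j k; split_ifs <;> simp
  simp_rw [this, Finset.sum_sub_distrib]
  simp only [Finset.sum_ite_eq, Finset.mem_univ, if_true]
  rw [sq, Finset.sum_mul_sum, sub_div, Finset.sum_div, Finset.sum_div]
  congr 1
  · exact Finset.sum_congr rfl fun j _ => by rw [Finset.sum_div]
  · exact Finset.sum_congr rfl fun j _ => by ring

end RBCA

namespace RBCA

/-! ### Independent gates -/

section Resample

variable {ι Ω : Type*} [Fintype ι] [DecidableEq ι]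

theorem prod_update_mul (μ : Ω → ℝ) (ω : ι → Ω) (v : ι) (q : Ω) :
    (∏ i, μ (Function.update ω v q i)) * μ (ω v) = (∏ i, μ (ω i)) * μ q := by
  rw [← Finset.mul_prod_erase Finset.univ _ (Finset.mem_univ v),
    ← Finset.mul_prod_erase Finset.univ (fun i => μ (ω i)) (Finset.mem_univ v)]
  have : ∏ i ∈ Finset.univ.erase v, μ (Function.update ω v q i) =
      ∏ i ∈ Finset.univ.erase v, μ (ω i) :=
    Finset.prod_congr rfl fun i hi => by rw [Function.update_of_ne (Finset.ne_of_mem_erase hi)]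
  rw [this, Function.update_self]
  ring

/-- Resampling one coordinate does not change the expectation. -/
theorem sum_resample [Fintype Ω] {μ : Ω → ℝ} (hμ : ∑ q, μ q = 1) (v : ι) (g : (ι → Ω) → ℝ) :
    ∑ ω : ι → Ω, (∏ i, μ (ω i)) * g ω =
      ∑ ω : ι → Ω, (∏ i, μ (ω i)) * ∑ q, μ q * g (Function.update ω v q) := by
  -- Exchanging the old coordinate with a fresh sample is an involution that preserves the product
  -- weight.
  let e : (ι → Ω) × Ω ≃ (ι → Ω) × Ω :=
    { toFun := fun z => (Function.update z.1 v z.2, z.1 v)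
      invFun := fun z => (Function.update z.1 v z.2, z.1 v)
      left_inv := fun z => by simp
      right_inv := fun z => by simp }
  have h1 : ∑ ω : ι → Ω, (∏ i, μ (ω i)) * g ω =
      ∑ z : (ι → Ω) × Ω, (∏ i, μ (z.1 i)) * μ z.2 * g z.1 := by
    rw [Fintype.sum_prod_type]
    refine Finset.sum_congr rfl fun ω _ => ?_
    dsimp only
    rw [← Finset.sum_mul, ← Finset.mul_sum, hμ, mul_one]
  rw [h1, ← e.sum_comp, Fintype.sum_prod_type]
  refine Finset.sum_congr rfl fun ω _ => ?_
  rw [Finset.mul_sum]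
  refine Finset.sum_congr rfl fun q _ => ?_
  simp only [e, Equiv.coe_fn_mk]
  rw [prod_update_mul]
  ring

end Resample

/-- The data of one gate: its inputs and its function. -/
abbrev Gate (n : ℕ) : Type := InputPair n × BoolFn

/-- The data of all gates. -/
abbrev Net (n : ℕ) : Type := Fin n → Gate n

/-- The probability of the data of a gate. -/
noncomputable def gateWeight (p : BoolFn → ℝ) {n : ℕ} (q : Gate n) : ℝ :=
  1 / (n.choose 2 : ℝ) * p q.2

/-- The expectation over the random gates. -/
noncomputable def ex (p : BoolFn → ℝ) {n : ℕ} (g : Net n → ℝ) : ℝ :=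
  ∑ ω : Net n, (∏ i, gateWeight p (ω i)) * g ω

variable {p : BoolFn → ℝ} {n : ℕ}

theorem choose_two_eq (n : ℕ) : (n.choose 2 : ℝ) = n * (n - 1) / 2 := Nat.cast_choose_two ℝ n

theorem card_inputPair (n : ℕ) : (Fintype.card (InputPair n) : ℝ) = n.choose 2 := by
  have h := sum_inputPair_add (n := n) fun _ => (1 / 2 : ℝ)
  norm_num at h
  rw [choose_two_eq, h]
  ring

theorem sum_gateWeight_mul (g : Gate n → ℝ) :
    ∑ q : Gate n, gateWeight p q * g q =
      1 / (n.choose 2 : ℝ) * ∑ q : InputPair n, ∑ f : BoolFn, p f * g (q, f) := by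
  rw [Fintype.sum_prod_type, Finset.mul_sum]
  refine Finset.sum_congr rfl fun q _ => ?_
  rw [Finset.mul_sum]
  exact Finset.sum_congr rfl fun f _ => by simp only [gateWeight]; ring

theorem sum_gateWeight (hp : IsDistribution p) (hn : 2 ≤ n) :
    ∑ q : Gate n, gateWeight p q = 1 := by
  have h := sum_gateWeight_mul (p := p) (n := n) fun _ => 1
  simp only [mul_one, hp.sum_eq_one, Finset.sum_const, Finset.card_univ, nsmul_eq_mul] at h
  rw [h, card_inputPair]
  have : 0 < n.choose 2 := Nat.choose_pos hn
  field_simp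

theorem gateWeight_nonneg (hp : IsDistribution p) (q : Gate n) : 0 ≤ gateWeight p q :=
  mul_nonneg (by positivity) (hp.nonneg _)

theorem netWeight_nonneg (hp : IsDistribution p) (ω : Net n) : 0 ≤ ∏ i, gateWeight p (ω i) :=
  Finset.prod_nonneg fun i _ => gateWeight_nonneg hp (ω i)

theorem sum_netWeight (hp : IsDistribution p) (hn : 2 ≤ n) :
    ∑ ω : Net n, ∏ i, gateWeight p (ω i) = 1 := by
  have h := Fintype.prod_sum fun (_ : Fin n) (q : Gate n) => gateWeight p q
  rw [← h]
  simp [sum_gateWeight hp hn]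

theorem ex_mono (hp : IsDistribution p) {g h : Net n → ℝ} (H : ∀ ω, g ω ≤ h ω) :
    ex p g ≤ ex p h :=
  Finset.sum_le_sum fun ω _ => mul_le_mul_of_nonneg_left (H ω) (netWeight_nonneg hp ω)

theorem ex_const (hp : IsDistribution p) (hn : 2 ≤ n) (r : ℝ) : ex p (fun _ : Net n => r) = r := by
  rw [ex, ← Finset.sum_mul, sum_netWeight hp hn, one_mul]

theorem ex_add (g h : Net n → ℝ) : ex p (fun ω => g ω + h ω) = ex p g + ex p h := by
  simp only [ex, mul_add, Finset.sum_add_distrib]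

theorem ex_mul_left (r : ℝ) (g : Net n → ℝ) : ex p (fun ω => r * g ω) = r * ex p g := by
  simp only [ex, Finset.mul_sum]
  exact Finset.sum_congr rfl fun ω _ => by ring

theorem ex_sub (g h : Net n → ℝ) : ex p (fun ω => g ω - h ω) = ex p g - ex p h := by
  simp only [ex, mul_sub, Finset.sum_sub_distrib]

theorem ex_sum {ι : Type*} (s : Finset ι) (g : ι → Net n → ℝ) :
    ex p (fun ω => ∑ i ∈ s, g i ω) = ∑ i ∈ s, ex p (g i) := by
  simp only [ex, Finset.mul_sum]
  exact Finset.sum_comm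

theorem ex_pow_le (hp : IsDistribution p) (hn : 2 ≤ n) {g : Net n → ℝ} (H : ∀ ω, 0 ≤ g ω)
    (m : ℕ) : ex p g ^ m ≤ ex p fun ω => g ω ^ m :=
  Real.pow_arith_mean_le_arith_mean_pow Finset.univ _ _ (fun ω _ => netWeight_nonneg hp ω)
    (sum_netWeight hp hn) (fun ω _ => H ω) m

theorem ex_resample (hp : IsDistribution p) (hn : 2 ≤ n) (v : Fin n) (g : Net n → ℝ) :
    ex p g = ex p fun ω => ∑ q, gateWeight p q * g (Function.update ω v q) :=
  sum_resample (sum_gateWeight hp hn) v g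

/-- The factors that involve the data of one gate each can be averaged separately. -/
theorem ex_prod {ι : Type*} [Fintype ι] [DecidableEq ι] (hp : IsDistribution p) (hn : 2 ≤ n)
    {s : ι → Fin n} (hs : Function.Injective s) (b : ι → Net n → Gate n → ℝ)
    (hb : ∀ i j ω q r, b i (Function.update ω (s j) q) r = b i ω r) :
    ex p (fun ω => ∏ i, b i ω (ω (s i))) =
      ex p fun ω => ∏ i, ∑ q, gateWeight p q * b i ω q := by
  -- The extra factor `R` collects the factors already averaged, which no longer depend on the gates
  -- `s j`.
  have key : ∀ T : Finset ι, ∀ R : Net n → ℝ,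
      (∀ j ω q, R (Function.update ω (s j) q) = R ω) →
      ex p (fun ω => (∏ i ∈ T, b i ω (ω (s i))) * R ω) =
        ex p fun ω => (∏ i ∈ T, ∑ q, gateWeight p q * b i ω q) * R ω := by
    intro T
    induction T using Finset.induction_on with
    | empty => intro R _; simp
    | insert v T hv ih =>
      intro R hR
      have hR' : ∀ j ω q, (fun ω => (∑ q, gateWeight p q * b v ω q) * R ω)
          (Function.update ω (s j) q) = (∑ q, gateWeight p q * b v ω q) * R ω := by
        intro j ω q
        simp only [hR, hb]
      rw [ex_resample hp hn (s v)]
      have h1 := ih (fun ω => (∑ q, gateWeight p q * b v ω q) * R ω) hR'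
      refine Eq.trans (congrArg (ex p) ?_) (h1.trans (congrArg (ex p) ?_))
      · funext ω
        have hT : ∀ q, ∏ i ∈ T, b i ω (Function.update ω (s v) q (s i)) =
            ∏ i ∈ T, b i ω (ω (s i)) := by
          intro q
          refine Finset.prod_congr rfl fun i hi => ?_
          have : s i ≠ s v := fun h => hv (hs h ▸ hi)
          rw [Function.update_of_ne this]
        simp only [Finset.prod_insert hv, hb, hT, hR, Function.update_self]
        rw [Finset.sum_mul, Finset.mul_sum]
        exact Finset.sum_congr rfl fun q _ => by ring
      · funext ω
        rw [Finset.prod_insert hv]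
        ring
  simpa using key Finset.univ (fun _ => 1) (fun _ _ _ => rfl)

/-! ### Three-valued simulation with clamped gates -/

/-- Three-valued simulation from the partial state `σ`; the gates in `Z` are kept undetermined. -/
def krun (ω : Net n) (Z : Finset (Fin n)) (σ : Fin n → Option Bool) : ℕ → Fin n → Option Bool
  | 0 => fun v => if v ∈ Z then none else σ v
  | t + 1 => fun v => if v ∈ Z then none else
      keval (ω v).2 (krun ω Z σ t (ω v).1.1.1) (krun ω Z σ t (ω v).1.1.2)

theorem krun_succ {ω : Net n} {Z : Finset (Fin n)} {σ : Fin n → Option Bool} {t : ℕ} {v : Fin n}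
    (hv : v ∉ Z) : krun ω Z σ (t + 1) v =
      keval (ω v).2 (krun ω Z σ t (ω v).1.1.1) (krun ω Z σ t (ω v).1.1.2) := by
  simp only [krun, if_neg hv]

theorem krun_of_mem {ω : Net n} {Z : Finset (Fin n)} {σ : Fin n → Option Bool} {t : ℕ} {v : Fin n}
    (hv : v ∈ Z) : krun ω Z σ t v = none := by
  cases t <;> simp only [krun, if_pos hv]

/-- A clamped gate is never evaluated, so its data are not read. This makes the simulation
independent of the clamped gates. -/
theorem krun_congr {ω ω' : Net n} {Z : Finset (Fin n)} (h : ∀ v, v ∉ Z → ω v = ω' v)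
    (σ : Fin n → Option Bool) (t : ℕ) : krun ω Z σ t = krun ω' Z σ t := by
  induction t with
  | zero => rfl
  | succ t ih =>
    funext v
    by_cases hv : v ∈ Z
    · rw [krun_of_mem hv, krun_of_mem hv]
    · rw [krun_succ hv, krun_succ hv, ih, h v hv]

theorem krun_update {ω : Net n} {Z : Finset (Fin n)} {v : Fin n} (hv : v ∈ Z) (q : Gate n)
    (σ : Fin n → Option Bool) (t : ℕ) : krun (Function.update ω v q) Z σ t = krun ω Z σ t :=
  krun_congr (fun _ hu => Function.update_of_ne (ne_of_mem_of_not_mem hv hu).symm _ _) σ t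

theorem krun_anti (ω : Net n) {Z Z' : Finset (Fin n)} (h : Z ⊆ Z') (σ : Fin n → Option Bool)
    (t : ℕ) (v : Fin n) : InfoLE (krun ω Z' σ t v) (krun ω Z σ t v) := by
  induction t generalizing v with
  | zero =>
    by_cases hv : v ∈ Z'
    · rw [krun_of_mem hv]; exact infoLE_none _
    · have : v ∉ Z := fun h' => hv (h h')
      simp only [krun, if_neg hv, if_neg this]; exact InfoLE.refl _
  | succ t ih =>
    by_cases hv : v ∈ Z'
    · rw [krun_of_mem hv]; exact infoLE_none _
    · rw [krun_succ hv, krun_succ fun h' => hv (h h')]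
      exact keval_mono _ (ih _) (ih _)

/-- The partial state in which nothing is known. -/
abbrev unknown : Fin n → Option Bool := fun _ => none

theorem krun_unknown_le_succ (ω : Net n) (Z : Finset (Fin n)) (t : ℕ) (v : Fin n) :
    InfoLE (krun ω Z unknown t v) (krun ω Z unknown (t + 1) v) := by
  induction t generalizing v with
  | zero => simp only [krun, unknown, ite_self]; exact infoLE_none _
  | succ t ih =>
    by_cases hv : v ∈ Z
    · rw [krun_of_mem hv]; exact infoLE_none _
    · rw [krun_succ hv, krun_succ hv]
      exact keval_mono _ (ih _) (ih _)

theorem krun_unknown_mono (ω : Net n) (Z : Finset (Fin n)) {t t' : ℕ} (h : t ≤ t') (v : Fin n) :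
    InfoLE (krun ω Z unknown t v) (krun ω Z unknown t' v) := by
  induction t', h using Nat.le_induction with
  | base => exact InfoLE.refl _
  | succ t' _ ih => exact ih.trans (krun_unknown_le_succ ω Z t' v)

/-- The automaton with the gates `ω` and the initial state `x`. -/
def aut (ω : Net n) (x : Fin n → Bool) : Automaton n := ⟨fun i => (ω i).1, fun i => (ω i).2, x⟩

theorem state_zero (ω : Net n) (x : Fin n → Bool) : (aut ω x).state 0 = x := rfl

theorem state_succ (ω : Net n) (x : Fin n → Bool) (t : ℕ) (v : Fin n) :
    (aut ω x).state (t + 1) v =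
      (ω v).2 ((aut ω x).state t (ω v).1.1.1) ((aut ω x).state t (ω v).1.1.2) := by
  simp only [Automaton.state, Function.iterate_succ_apply']
  rfl

/-- Values found by the three-valued simulation are correct. -/
theorem krun_sound (ω : Net n) (x : Fin n → Bool) (Z : Finset (Fin n)) {σ : Fin n → Option Bool}
    {s : ℕ} (hσ : ∀ v, InfoLE (σ v) (some ((aut ω x).state s v))) (t : ℕ) (v : Fin n) :
    InfoLE (krun ω Z σ t v) (some ((aut ω x).state (s + t) v)) := by
  induction t generalizing v with
  | zero =>
    by_cases hv : v ∈ Z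
    · rw [krun_of_mem hv]; exact infoLE_none _
    · simp only [krun, if_neg hv]; exact hσ v
  | succ t ih =>
    by_cases hv : v ∈ Z
    · rw [krun_of_mem hv]; exact infoLE_none _
    · rw [krun_succ hv]
      intro b hb
      rw [← add_assoc, state_succ, keval_sound _ (ih _) (ih _) hb]

/-- Nothing is assumed about the starting state, so the simulation may be started at time `t - h`: a
value found in `h` steps persists forever. -/
theorem krun_unknown_sound (ω : Net n) (x : Fin n → Bool) (Z : Finset (Fin n)) {h : ℕ} {v : Fin n}
    {b : Bool} (hb : krun ω Z unknown h v = some b) {t : ℕ} (ht : h ≤ t) :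
    (aut ω x).state t v = b := by
  have := krun_sound ω x Z (s := t - h) (fun _ => infoLE_none _) h v b hb
  rw [Nat.sub_add_cancel ht] at this
  simpa using this

theorem krun_known_sound (ω : Net n) (x : Fin n → Bool) (Z : Finset (Fin n)) {t : ℕ} {v : Fin n}
    {b : Bool} (hb : krun ω Z (fun v => some (x v)) t v = some b) :
    (aut ω x).state t v = b := by
  have := krun_sound ω x Z (s := 0) (σ := fun v => some (x v))
    (fun v => by rw [state_zero]; exact InfoLE.refl _) t v b hb
  rw [zero_add] at this
  simpa using this

end RBCA

namespace RBCA

/-! ### The expected fraction of undetermined gates -/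

variable {p : BoolFn → ℝ} {n : ℕ}

/-- The number of gates without a value in a partial state. -/
noncomputable def unk (τ : Fin n → Option Bool) : ℝ := ∑ v, if τ v = none then 1 else 0

theorem unk_le (τ : Fin n → Option Bool) : unk τ ≤ n := by
  have : unk τ ≤ ∑ _v : Fin n, (1 : ℝ) :=
    Finset.sum_le_sum fun v _ => by split_ifs <;> norm_num
  simpa using this

theorem one_le_unk {τ : Fin n → Option Bool} {v : Fin n} (hv : τ v = none) : 1 ≤ unk τ := by
  have := Finset.single_le_sum (f := fun v => if τ v = none then (1 : ℝ) else 0)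
    (fun v _ => by split_ifs <;> norm_num) (Finset.mem_univ v)
  simpa [hv, unk] using this

theorem mass_gate_none (hp : IsDistribution p) (hs : IsSymmetric p)
    (hac : probConstant p = probNonCanalyzing p) (hn : 2 ≤ n) (τ : Fin n → Option Bool) :
    ∑ q : Gate n, gateWeight p q * (if keval q.2 (τ q.1.1.1) (τ q.1.1.2) = none then 1 else 0) =
      unk τ / n - probNonCanalyzing p * (unk τ * (unk τ - 1) / (n * (n - 1))) := by
  rw [sum_gateWeight_mul]
  simp only [mass_keval_none hp hs hac]
  rw [Finset.sum_sub_distrib, ← Finset.sum_div, ← Finset.mul_sum,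
    sum_inputPair_add fun j => if τ j = none then (1 : ℝ) else 0,
    sum_inputPair_mul fun j => if τ j = none then (1 : ℝ) else 0]
  have h1 : ∑ j, (if τ j = none then (1 : ℝ) else 0) ^ 2 = unk τ :=
    Finset.sum_congr rfl fun j _ => by split_ifs <;> norm_num
  have h0 : ∑ j, (if τ j = none then (1 : ℝ) else 0) = unk τ := rfl
  rw [h1, h0, choose_two_eq]
  have h2 : (2 : ℝ) ≤ n := by exact_mod_cast hn
  have h3 : (n : ℝ) - 1 ≠ 0 := by linarith
  have h4 : (n : ℝ) ≠ 0 := by linarith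
  field_simp

/-- Clamping `v` as well makes the states of its inputs independent of its own data, and by
monotonicity can only increase the number of undetermined gates. -/
theorem ex_gate_none_le (hp : IsDistribution p) (hs : IsSymmetric p)
    (hac : probConstant p = probNonCanalyzing p) (hn : 2 ≤ n) (σ : Fin n → Option Bool)
    (Z : Finset (Fin n)) (t : ℕ) {v : Fin n} (hv : v ∉ Z) :
    ex p (fun ω => if krun ω Z σ (t + 1) v = none then 1 else 0) ≤
      ex p fun ω => unk (krun ω (insert v Z) σ t) / n - probNonCanalyzing p *
        (unk (krun ω (insert v Z) σ t) * (unk (krun ω (insert v Z) σ t) - 1) / (n * (n - 1))) := by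
  rw [ex_resample hp hn v]
  refine ex_mono hp fun ω => ?_
  rw [← mass_gate_none hp hs hac hn]
  refine Finset.sum_le_sum fun q _ => mul_le_mul_of_nonneg_left ?_ (gateWeight_nonneg hp q)
  rw [krun_succ hv, Function.update_self]
  have h : ∀ u, InfoLE (krun ω (insert v Z) σ t u) (krun (Function.update ω v q) Z σ t u) := by
    intro u
    rw [← krun_update (Finset.mem_insert_self v Z) q]
    exact krun_anti _ (Finset.subset_insert v Z) σ t u
  have h' := keval_mono q.2 (h q.1.1.1) (h q.1.1.2)
  by_cases h0 : keval q.2 (krun (Function.update ω v q) Z σ t q.1.1.1)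
      (krun (Function.update ω v q) Z σ t q.1.1.2) = none
  · rw [if_pos h0, if_pos (h'.eq_none h0)]
  · rw [if_neg h0]
    split_ifs <;> norm_num

/-- The expected fraction of undetermined gates. -/
noncomputable def unkFrac (p : BoolFn → ℝ) (Z : Finset (Fin n)) (σ : Fin n → Option Bool)
    (t : ℕ) : ℝ := ex p (fun ω => unk (krun ω Z σ t)) / n

/-- The map u ↦ u - c u² is concave, so its tangent at `A` bounds it from above and needs only the
expectation of u. The slope lies in [0, 1], so the error `δ` is not amplified. The term in `Z.card +
1` pays for the clamped gates and for drawing inputs without replacement. -/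
theorem unkFrac_succ_le (hp : IsDistribution p) (hs : IsSymmetric p)
    (hac : probConstant p = probNonCanalyzing p) (hn : 2 ≤ n) (σ : Fin n → Option Bool)
    (Z : Finset (Fin n)) (t : ℕ) {A δ : ℝ} (hA : 0 ≤ A) (hA' : 2 * probNonCanalyzing p * A ≤ 1)
    (hδ : 0 ≤ δ) (h : ∀ v, v ∉ Z → unkFrac p (insert v Z) σ t ≤ A + δ) :
    unkFrac p Z σ (t + 1) ≤ (Z.card + 1 : ℝ) / n + (A - probNonCanalyzing p * A ^ 2) + δ := by
  set c := probNonCanalyzing p with hc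
  have hc0 : 0 ≤ c := probNonCanalyzing_nonneg hp
  have hc1 : c ≤ 1 / 2 := probNonCanalyzing_le_half hp hac
  have hn2 : (2 : ℝ) ≤ n := by exact_mod_cast hn
  have hn0 : (0 : ℝ) < n := by linarith
  have hv : ∀ v, v ∉ Z → ex p (fun ω => if krun ω Z σ (t + 1) v = none then 1 else 0) ≤
      1 / n + (A - c * A ^ 2) + δ := by
    intro v hv
    refine (ex_gate_none_le hp hs hac hn σ Z t hv).trans ?_
    -- The tangent bound, with 1/n to cover the replacement of u(u - 1)/(n(n - 1)) by (u/n)².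
    have hpt : ∀ ω : Net n, unk (krun ω (insert v Z) σ t) / n - c *
        (unk (krun ω (insert v Z) σ t) * (unk (krun ω (insert v Z) σ t) - 1) / (n * (n - 1))) ≤
        (1 - 2 * c * A) / n * unk (krun ω (insert v Z) σ t) + (c * A ^ 2 + 1 / n) := by
      intro ω
      have hu1 : 1 ≤ unk (krun ω (insert v Z) σ t) :=
        one_le_unk (krun_of_mem (Finset.mem_insert_self v Z))
      have hu2 := unk_le (krun ω (insert v Z) σ t)
      set u := unk (krun ω (insert v Z) σ t)
      have h1 : u * (u - 1) / (n * (n - 1)) ≥ u * (u - 1) / (n * n) := by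
        apply div_le_div_of_nonneg_left
        · exact mul_nonneg (by linarith) (by linarith)
        · exact mul_pos hn0 (by linarith)
        · exact mul_le_mul_of_nonneg_left (by linarith) hn0.le
      have h2 : u * (u - 1) / (n * n) = (u / n) ^ 2 - u / n / n := by field_simp
      have h3 : u / n ≤ 1 := (div_le_one hn0).2 hu2
      have h4 : u / n / n ≤ 1 / n := div_le_div_of_nonneg_right h3 hn0.le
      have h5 : c * ((u / n) ^ 2 - 1 / n) ≤ c * (u * (u - 1) / (n * (n - 1))) :=
        mul_le_mul_of_nonneg_left (by linarith) hc0
      have h6 : 0 ≤ c * (u / n - A) ^ 2 := mul_nonneg hc0 (sq_nonneg _)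
      have h7 : c * (1 / n) ≤ 1 * (1 / n) :=
        mul_le_mul_of_nonneg_right (by linarith) (by positivity)
      have h8 : (1 - 2 * c * A) / n * u = (1 - 2 * c * A) * (u / n) := by ring
      rw [h8]
      nlinarith
    refine (ex_mono hp hpt).trans ?_
    rw [ex_add, ex_mul_left, ex_const hp hn]
    have h9 := h v hv
    unfold unkFrac at h9
    have h10 : (1 - 2 * c * A) / n * ex p (fun ω => unk (krun ω (insert v Z) σ t)) =
        (1 - 2 * c * A) * (ex p (fun ω => unk (krun ω (insert v Z) σ t)) / n) := by ring
    rw [h10]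
    have h11 : (1 - 2 * c * A) * (ex p (fun ω => unk (krun ω (insert v Z) σ t)) / n) ≤
        (1 - 2 * c * A) * (A + δ) := mul_le_mul_of_nonneg_left h9 (by linarith)
    have h12 : 0 ≤ c * A * δ := by positivity
    nlinarith
  set B : ℝ := 1 / n + (A - c * A ^ 2) + δ with hB
  have hB0 : 0 ≤ B := by
    have : 0 ≤ A * (1 - c * A) := mul_nonneg hA (by nlinarith [mul_nonneg hc0 hA])
    have : (0 : ℝ) ≤ 1 / n := by positivity
    rw [hB]; nlinarith
  have hsum : ex p (fun ω => unk (krun ω Z σ (t + 1))) ≤ Z.card + n * B := by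
    have : ∀ v : Fin n, ex p (fun ω => if krun ω Z σ (t + 1) v = none then 1 else 0) ≤
        (if v ∈ Z then 1 else 0) + B := by
      intro v
      by_cases hvZ : v ∈ Z
      · rw [if_pos hvZ]
        refine (ex_mono hp (h := fun _ => 1) fun ω => by split_ifs <;> norm_num).trans ?_
        rw [ex_const hp hn]; linarith
      · rw [if_neg hvZ, zero_add]; exact hv v hvZ
    unfold unk
    rw [ex_sum]
    refine (Finset.sum_le_sum fun v _ => this v).trans ?_
    rw [Finset.sum_add_distrib]
    simp
  unfold unkFrac
  rw [div_le_iff₀ hn0]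
  refine hsum.trans (le_of_eq ?_)
  rw [hB]
  field_simp
  ring

/-- 1/(c(t + 2)) is a supersolution of the recursion A ↦ A - c A², and at t = 0 it is at least 1
since c ≤ 1/2. Each step back in time clamps one more gate, so `Z.card + t` stays within the budget
`M`. -/
theorem unkFrac_unknown_le (hp : IsDistribution p) (hs : IsSymmetric p)
    (hac : probConstant p = probNonCanalyzing p) (hne : probConstant p ≠ 0) (hn : 2 ≤ n) {M : ℕ}
    (t : ℕ) (Z : Finset (Fin n)) (h : Z.card + t ≤ M) :
    unkFrac p Z unknown t ≤ 1 / (probNonCanalyzing p * (t + 2)) + t * ((M + 1 : ℝ) / n) := by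
  have hn2 : (2 : ℝ) ≤ n := by exact_mod_cast hn
  have hn0 : (0 : ℝ) < n := by linarith
  have hc0 : 0 < probNonCanalyzing p :=
    lt_of_le_of_ne (probNonCanalyzing_nonneg hp) (hac ▸ hne.symm)
  have hc1 := probNonCanalyzing_le_half hp hac
  set c := probNonCanalyzing p with hc
  induction t generalizing Z with
  | zero =>
    have h1 : unkFrac p Z unknown 0 ≤ 1 := by
      unfold unkFrac
      rw [div_le_one hn0]
      exact (ex_mono hp fun ω => unk_le _).trans (ex_const hp hn _).le
    refine h1.trans ?_
    have : (1 : ℝ) ≤ 1 / (c * 2) := by rw [le_div_iff₀ (by positivity)]; linarith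
    simpa using this
  | succ t ih =>
    have ht : (0 : ℝ) < (t : ℝ) + 2 := by positivity
    have hZ : ((Z.card + 1 : ℝ)) / n ≤ (M + 1 : ℝ) / n := by
      apply div_le_div_of_nonneg_right _ hn0.le
      have : (Z.card : ℝ) ≤ M := by exact_mod_cast (by omega)
      linarith
    have key := unkFrac_succ_le hp hs hac hn unknown Z t (A := 1 / (c * (t + 2)))
      (δ := t * ((M + 1 : ℝ) / n)) (by positivity) (by
        rw [← hc]
        have : 2 * c * (1 / (c * (t + 2))) = 2 / (t + 2) := by field_simp
        rw [this, div_le_one ht]; linarith [(Nat.cast_nonneg t : (0 : ℝ) ≤ t)])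
      (by positivity) (fun v hv => ih (insert v Z) (by
        have := Finset.card_insert_le v Z; omega))
    rw [← hc] at key
    have h2 : 1 / (c * (t + 2)) - c * (1 / (c * (t + 2))) ^ 2 ≤ 1 / (c * ((t + 1 : ℕ) + 2)) := by
      have : 1 / (c * (t + 2)) - c * (1 / (c * (t + 2))) ^ 2 =
          (t + 1) / (c * (t + 2) ^ 2) := by field_simp; ring
      rw [this, div_le_div_iff₀ (by positivity) (by positivity)]
      push_cast
      have : ((t : ℝ) + 1) * (t + 1 + 2) ≤ (t + 2) ^ 2 := by nlinarith
      nlinarith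
    push_cast at h2 ⊢
    linarith

/-- From a fully known state only clamping loses information, so the recursion runs with `A = 0`. -/
theorem unkFrac_known_le (hp : IsDistribution p) (hs : IsSymmetric p)
    (hac : probConstant p = probNonCanalyzing p) (hn : 2 ≤ n) {M : ℕ} (x : Fin n → Bool)
    (t : ℕ) (Z : Finset (Fin n)) (h : Z.card + t ≤ M) :
    unkFrac p Z (fun v => some (x v)) t ≤ (t + 1) * ((M + 1 : ℝ) / n) := by
  have hn2 : (2 : ℝ) ≤ n := by exact_mod_cast hn
  have hn0 : (0 : ℝ) < n := by linarith
  have hZ : ∀ (t : ℕ) (Z : Finset (Fin n)), Z.card + t ≤ M →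
      ((Z.card + 1 : ℝ)) / n ≤ (M + 1 : ℝ) / n := by
    intro t Z h
    apply div_le_div_of_nonneg_right _ hn0.le
    have : (Z.card : ℝ) ≤ M := by exact_mod_cast (by omega)
    linarith
  induction t generalizing Z with
  | zero =>
    have h1 : unkFrac p Z (fun v => some (x v)) 0 ≤ Z.card / n := by
      unfold unkFrac
      apply div_le_div_of_nonneg_right _ hn0.le
      refine (ex_mono hp (h := fun _ => (Z.card : ℝ)) fun ω => ?_).trans (ex_const hp hn _).le
      simp [unk, krun]
    refine h1.trans (le_trans ?_ ((hZ 0 Z h).trans (by simp)))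
    apply div_le_div_of_nonneg_right _ hn0.le
    linarith
  | succ t ih =>
    have key := unkFrac_succ_le hp hs hac hn (fun v => some (x v)) Z t (A := 0)
      (δ := (t + 1) * ((M + 1 : ℝ) / n)) le_rfl (by simp)
      (by positivity) (fun v hv => by
        rw [zero_add]
        exact ih (insert v Z) (by have := Finset.card_insert_le v Z; omega))
    have := hZ _ Z h
    push_cast
    linarith

end RBCA

namespace RBCA

variable {p : BoolFn → ℝ} {n : ℕ}

/-- The indicator of a proposition. -/
noncomputable def ind (P : Prop) : ℝ := by classical exact if P then 1 else 0

theorem ind_eq_ite (P : Prop) [Decidable P] : ind P = if P then 1 else 0 := by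
  unfold ind; congr

theorem ind_pos {P : Prop} (h : P) : ind P = 1 := by simp [ind, h]

theorem ind_neg {P : Prop} (h : ¬ P) : ind P = 0 := by simp [ind, h]

theorem ind_nonneg (P : Prop) : 0 ≤ ind P := by unfold ind; split_ifs <;> norm_num

theorem ind_mono {P Q : Prop} (h : P → Q) : ind P ≤ ind Q := by
  by_cases hP : P
  · rw [ind_pos hP, ind_pos (h hP)]
  · rw [ind_neg hP]; exact ind_nonneg Q

theorem ind_and (P Q : Prop) : ind (P ∧ Q) = ind P * ind Q := by
  by_cases hP : P <;> by_cases hQ : Q <;> simp [ind, hP, hQ]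

theorem prod_ind {ι : Type*} [Fintype ι] (P : ι → Prop) : ∏ a, ind (P a) = ind (∀ a, P a) := by
  classical
  simp only [ind_eq_ite]
  rw [Finset.prod_boole]
  simp

/-! ### Gates that copy or negate one input -/

/-- The gate with data `q` has the input `u`, its other input has a value in the partial state `τ`,
and with this value its function is injective in the input `u`. -/
def Feeds (q : Gate n) (u : Fin n) (τ : Fin n → Option Bool) : Prop :=
  (q.1.1.1 = u ∧ ∃ w, τ q.1.1.2 = some w ∧ q.2 false w ≠ q.2 true w) ∨
  (q.1.1.2 = u ∧ ∃ w, τ q.1.1.1 = some w ∧ q.2 w false ≠ q.2 w true)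

/-- The predicate `P` lets one computation serve both for arbitrary functions (`r = 1/2`) and for
non-canalyzing ones (`r = c`). -/
theorem sum_feeds_and (P : BoolFn → Prop) {r : ℝ}
    (h1 : ∀ w, ∑ f : BoolFn, p f * ind (f false w ≠ f true w ∧ P f) = r)
    (h2 : ∀ w, ∑ f : BoolFn, p f * ind (f w false ≠ f w true ∧ P f) = r)
    {u : Fin n} {τ : Fin n → Option Bool} (hu : τ u = none) (hn : 2 ≤ n) :
    ∑ q : Gate n, gateWeight p q * ind (Feeds q u τ ∧ P q.2) =
      2 * r * ((n - unk τ) / (n * (n - 1))) := by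
  classical
  rw [sum_gateWeight_mul]
  have key : ∀ q : InputPair n,
      ∑ f : BoolFn, p f * ind (Feeds (q, f) u τ ∧ P f) =
        (if q.1.1 = u then (if τ q.1.2 = none then 0 else r) else 0) +
        (if q.1.2 = u then (if τ q.1.1 = none then 0 else r) else 0) := by
    intro q
    have hne : q.1.1 ≠ q.1.2 := ne_of_lt q.2
    by_cases hq1 : q.1.1 = u
    · have hq2 : q.1.2 ≠ u := fun h => hne (hq1.trans h.symm)
      rw [if_pos hq1, if_neg hq2, add_zero]
      cases hτ : τ q.1.2 with
      | none => simp [Feeds, hτ, hq2, ind]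
      | some w =>
        rw [if_neg (by simp), ← h1 w]
        refine Finset.sum_congr rfl fun f _ => ?_
        simp [Feeds, hτ, hq1, hq2, ind]
    · rw [if_neg hq1, zero_add]
      by_cases hq2 : q.1.2 = u
      · rw [if_pos hq2]
        cases hτ : τ q.1.1 with
        | none => simp [Feeds, hτ, hq1, ind]
        | some w =>
          rw [if_neg (by simp), ← h2 w]
          refine Finset.sum_congr rfl fun f _ => ?_
          simp [Feeds, hτ, hq1, hq2, ind]
      · rw [if_neg hq2]
        simp [Feeds, hq1, hq2, ind]
  simp_rw [key]
  rw [sum_inputPair fun j k => if j = u then (if τ k = none then 0 else r) else 0]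
  have h3 : ∑ j, ∑ k, (if j = k then (0 : ℝ) else
      if j = u then (if τ k = none then 0 else r) else 0) = r * (n - unk τ) := by
    rw [Finset.sum_eq_single u (fun j _ hj => by simp [hj]) (fun h => by simp at h)]
    have : ∀ k, (if u = k then (0 : ℝ) else
        if u = u then (if τ k = none then 0 else r) else 0) =
        r - r * (if τ k = none then 1 else 0) := by
      intro k
      -- Excluding `k = u` costs nothing, because `u` itself has no value in `τ`.
      by_cases hk : u = k
      · subst hk; simp [hu]
      · by_cases hk' : τ k = none <;> simp [hk, hk']
    rw [Finset.sum_congr rfl fun k _ => this k, Finset.sum_sub_distrib, ← Finset.mul_sum]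
    simp [unk]
    ring
  rw [h3, choose_two_eq]
  have h2 : (2 : ℝ) ≤ n := by exact_mod_cast hn
  have h3 : (n : ℝ) - 1 ≠ 0 := by linarith
  have h4 : (n : ℝ) ≠ 0 := by linarith
  field_simp

theorem mass_feeds (hp : IsDistribution p) (hs : IsSymmetric p)
    (hac : probConstant p = probNonCanalyzing p) (hn : 2 ≤ n)
    {u : Fin n} {τ : Fin n → Option Bool} (hu : τ u = none) :
    ∑ q : Gate n, gateWeight p q * ind (Feeds q u τ) =
      (n - unk τ) / (n * (n - 1)) := by
  have h := sum_feeds_and (p := p) (fun _ => True) (r := 1 / 2)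
    (fun w => by simpa [ind_eq_ite] using mass_fst hp hs hac w)
    (fun w => by simpa [ind_eq_ite] using mass_snd hp hs hac w)
    hu hn
  simpa using h

theorem mass_feeds_classC (hn : 2 ≤ n) {u : Fin n} {τ : Fin n → Option Bool} (hu : τ u = none) :
    ∑ q : Gate n, gateWeight p q * ind (Feeds q u τ ∧ q.2.ClassC) =
      2 * probNonCanalyzing p * ((n - unk τ) / (n * (n - 1))) := by
  refine sum_feeds_and (p := p) (fun f => f.ClassC) (fun w => ?_) (fun w => ?_) hu hn
  · rw [← sum_classC]
    refine Finset.sum_congr rfl fun f _ => ?_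
    by_cases hf : f.ClassC
    · rw [if_pos hf, ind_pos ⟨(classC_sens f hf w).1, hf⟩]
    · rw [if_neg hf, ind_neg fun h => hf h.2]
  · rw [← sum_classC]
    refine Finset.sum_congr rfl fun f _ => ?_
    by_cases hf : f.ClassC
    · rw [if_pos hf, ind_pos ⟨(classC_sens f hf w).2, hf⟩]
    · rw [if_neg hf, ind_neg fun h => hf h.2]

/-! ### Probability that prescribed gates are wired along a map -/

section Wired

variable {ι : Type*} [Fintype ι]

/-- Each gate `s a` copies or negates the gate `s (π a)`, given the values in `τ`. -/
def Wired (ω : Net n) (s : ι → Fin n) (π : ι → ι) (τ : Fin n → Option Bool) : Prop :=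
  ∀ a, Feeds (ω (s a)) (s (π a)) τ

/-- The partial state `T` ignores the data of the gates `s a`, so these are independent given `T`,
and each contributes its own mass. -/
theorem ex_wired (hp : IsDistribution p) (hs : IsSymmetric p)
    (hac : probConstant p = probNonCanalyzing p) (hn : 2 ≤ n) {s : ι → Fin n}
    (hsi : Function.Injective s) (π : ι → ι) (R : Finset ι) (T : Net n → Fin n → Option Bool)
    (hT : ∀ a ω q, T (Function.update ω (s a) q) = T ω) (hT' : ∀ a ω, T ω (s a) = none) :
    ex p (fun ω => ind (Wired ω s π (T ω) ∧ ∀ a ∈ R, (ω (s a)).2.ClassC)) =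
      (2 * probNonCanalyzing p) ^ R.card *
        ex p fun ω => ((n - unk (T ω)) / (n * (n - 1))) ^ Fintype.card ι := by
  classical
  have h1 : ∀ ω : Net n, ind (Wired ω s π (T ω) ∧ ∀ a ∈ R, (ω (s a)).2.ClassC) =
      ∏ a, ind (Feeds (ω (s a)) (s (π a)) (T ω) ∧ (a ∈ R → (ω (s a)).2.ClassC)) := by
    intro ω
    rw [prod_ind]
    simp only [Wired, forall_and]
  simp_rw [h1]
  rw [ex_prod hp hn hsi (fun a ω q => ind (Feeds q (s (π a)) (T ω) ∧ (a ∈ R → q.2.ClassC)))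
    (fun i j ω q r => by simp only [hT]), ← ex_mul_left]
  congr 1
  funext ω
  have h2 : ∀ a, ∑ q : Gate n, gateWeight p q *
      ind (Feeds q (s (π a)) (T ω) ∧ (a ∈ R → q.2.ClassC)) =
      (if a ∈ R then 2 * probNonCanalyzing p else 1) * ((n - unk (T ω)) / (n * (n - 1))) := by
    intro a
    by_cases ha : a ∈ R
    · simp only [ha, true_implies, if_true]
      exact mass_feeds_classC hn (hT' _ ω)
    · simp only [ha, false_implies, and_true, if_false, one_mul]
      exact mass_feeds hp hs hac hn (hT' _ ω)
  simp_rw [h2]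
  rw [Finset.prod_mul_distrib, Finset.prod_const, Finset.card_univ]
  congr 1
  rw [Finset.prod_ite_mem, Finset.univ_inter, Finset.prod_const]

/-- The set of the gates of a system of cycles. -/
def gates [DecidableEq ι] (s : ι → Fin n) : Finset (Fin n) := Finset.univ.image s

theorem mem_gates [DecidableEq ι] (s : ι → Fin n) (a : ι) : s a ∈ gates s :=
  Finset.mem_image_of_mem s (Finset.mem_univ a)

theorem card_gates_le [DecidableEq ι] (s : ι → Fin n) : (gates s).card ≤ Fintype.card ι :=
  Finset.card_image_le

variable [DecidableEq ι]

/-- At least one gate is clamped, hence undetermined; this one compensates the denominator n - 1. -/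
theorem ex_wired_le (hp : IsDistribution p) (hs : IsSymmetric p)
    (hac : probConstant p = probNonCanalyzing p) (hn : 2 ≤ n) {s : ι → Fin n}
    (hsi : Function.Injective s) (π : ι → ι) (H : ℕ) :
    ex p (fun ω => ind (Wired ω s π (krun ω (gates s) unknown H))) ≤
      (1 / (n : ℝ)) ^ Fintype.card ι := by
  have h := ex_wired hp hs hac hn hsi π ∅ (fun ω => krun ω (gates s) unknown H)
    (fun a ω q => krun_update (mem_gates s a) q _ _) (fun a ω => krun_of_mem (mem_gates s a))
  simp only [Finset.notMem_empty, false_implies, implies_true, and_true, Finset.card_empty,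
    pow_zero, one_mul] at h
  rw [h]
  refine (ex_mono hp fun ω => ?_).trans (ex_const hp hn _).le
  have hn2 : (2 : ℝ) ≤ n := by exact_mod_cast hn
  rcases isEmpty_or_nonempty ι with hι | ⟨⟨a⟩⟩
  · simp
  · have h1 : 1 ≤ unk (krun ω (gates s) unknown H) := one_le_unk (krun_of_mem (mem_gates s a))
    have h2 := unk_le (krun ω (gates s) unknown H)
    have h3 : 0 < (n : ℝ) * (n - 1) := mul_pos (by linarith) (by linarith)
    apply pow_le_pow_left₀ (div_nonneg (by linarith) h3.le)
    rw [div_le_div_iff₀ h3 (by linarith)]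
    nlinarith

/-- The gates whose state is found at all times, from the initial state `x` before time `H` and
from nothing at time `H`, with their final values. -/
noncomputable def settled (ω : Net n) (Z : Finset (Fin n)) (x : Fin n → Bool) (H : ℕ) :
    Fin n → Option Bool := by
  classical exact fun v =>
    if ∀ t < H, krun ω Z (fun v => some (x v)) t v ≠ none then krun ω Z unknown H v else none

theorem settled_le (ω : Net n) (Z : Finset (Fin n)) (x : Fin n → Bool) (H : ℕ) (v : Fin n) :
    InfoLE (settled ω Z x H v) (krun ω Z unknown H v) := by
  unfold settled
  split_ifs
  · exact InfoLE.refl _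
  · exact infoLE_none _

theorem settled_known {ω : Net n} {Z : Finset (Fin n)} {x : Fin n → Bool} {H : ℕ} {v : Fin n}
    {b : Bool} (h : settled ω Z x H v = some b) {t : ℕ} (ht : t < H) :
    krun ω Z (fun v => some (x v)) t v ≠ none := by
  unfold settled at h
  split_ifs at h with h1
  exact h1 t ht

theorem settled_congr {ω ω' : Net n} {Z : Finset (Fin n)} (h : ∀ v, v ∉ Z → ω v = ω' v)
    (x : Fin n → Bool) (H : ℕ) : settled ω Z x H = settled ω' Z x H := by
  unfold settled
  simp only [krun_congr h]

theorem settled_of_mem {ω : Net n} {Z : Finset (Fin n)} {x : Fin n → Bool} {H : ℕ} {v : Fin n}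
    (hv : v ∈ Z) : settled ω Z x H v = none :=
  (settled_le ω Z x H v).eq_none (krun_of_mem hv)

theorem unk_settled_le (ω : Net n) (Z : Finset (Fin n)) (x : Fin n → Bool) (H : ℕ) :
    unk (settled ω Z x H) ≤ unk (krun ω Z unknown H) +
      ∑ t ∈ Finset.range H, unk (krun ω Z (fun v => some (x v)) t) := by
  unfold unk
  rw [Finset.sum_comm, ← Finset.sum_add_distrib]
  refine Finset.sum_le_sum fun v _ => ?_
  have h0 : ∀ t ∈ Finset.range H,
      (0 : ℝ) ≤ if krun ω Z (fun v => some (x v)) t v = none then 1 else 0 :=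
    fun t _ => by split_ifs <;> norm_num
  by_cases h : ∀ t < H, krun ω Z (fun v => some (x v)) t v ≠ none
  · have : settled ω Z x H v = krun ω Z unknown H v := by
      unfold settled; rw [if_pos h]
    rw [this]
    linarith [Finset.sum_nonneg h0]
  · push Not at h
    obtain ⟨t, ht, htv⟩ := h
    have h1 := Finset.single_le_sum h0 (Finset.mem_range.2 ht)
    rw [if_pos htv] at h1
    have h2 : (if settled ω Z x H v = none then (1 : ℝ) else 0) ≤ 1 := by split_ifs <;> norm_num
    have h3 : (0 : ℝ) ≤ if krun ω Z unknown H v = none then 1 else 0 := by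
      split_ifs <;> norm_num
    linarith

theorem ex_unk_settled_le (hp : IsDistribution p) (hs : IsSymmetric p)
    (hac : probConstant p = probNonCanalyzing p) (hne : probConstant p ≠ 0) (hn : 2 ≤ n)
    (x : Fin n → Bool) (H : ℕ) (Z : Finset (Fin n)) :
    ex p (fun ω => unk (settled ω Z x H)) / n ≤ 1 / (probNonCanalyzing p * (H + 2)) +
      (H + H ^ 2) * (((Z.card + H : ℕ) + 1 : ℝ) / n) := by
  have hn2 : (2 : ℝ) ≤ n := by exact_mod_cast hn
  have hn0 : (0 : ℝ) < n := by linarith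
  set ε : ℝ := ((Z.card + H : ℕ) + 1 : ℝ) / n with hε
  have hε0 : 0 ≤ ε := by positivity
  have h1 := unkFrac_unknown_le hp hs hac hne hn (M := Z.card + H) H Z le_rfl
  have h2 : ∀ t ∈ Finset.range H, unkFrac p Z (fun v => some (x v)) t ≤ H * ε := by
    intro t ht
    have ht' := Finset.mem_range.1 ht
    refine (unkFrac_known_le hp hs hac hn (M := Z.card + H) x t Z (by omega)).trans ?_
    refine mul_le_mul_of_nonneg_right ?_ hε0
    exact_mod_cast ht'
  have h3 : ex p (fun ω => unk (settled ω Z x H)) / n ≤ unkFrac p Z unknown H +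
      ∑ t ∈ Finset.range H, unkFrac p Z (fun v => some (x v)) t := by
    unfold unkFrac
    rw [← Finset.sum_div, ← add_div]
    refine div_le_div_of_nonneg_right ?_ hn0.le
    rw [← ex_sum, ← ex_add]
    exact ex_mono hp fun ω => unk_settled_le ω Z x H
  have h4 := Finset.sum_le_sum h2
  rw [Finset.sum_const, Finset.card_range, nsmul_eq_mul] at h4
  have : (H + H ^ 2 : ℝ) * ε = H * ε + H * (H * ε) := by ring
  rw [this]
  linarith

/-- By Jensen's inequality for the power, only the expected number of unsettled gates matters, not
its distribution. -/
theorem le_ex_wired_settled (hp : IsDistribution p) (hs : IsSymmetric p)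
    (hac : probConstant p = probNonCanalyzing p) (hn : 2 ≤ n) {s : ι → Fin n}
    (hsi : Function.Injective s) (π : ι → ι) (R : Finset ι) (x : Fin n → Bool) (H : ℕ) {X : ℝ}
    (hX : ex p (fun ω => unk (settled ω (gates s) x H)) / n ≤ X) (hX1 : X ≤ 1) :
    (2 * probNonCanalyzing p) ^ R.card * ((1 / (n : ℝ)) ^ Fintype.card ι *
      (1 - X) ^ Fintype.card ι) ≤
    ex p (fun ω => ind (Wired ω s π (settled ω (gates s) x H) ∧ ∀ a ∈ R, (ω (s a)).2.ClassC)) := by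
  have hn2 : (2 : ℝ) ≤ n := by exact_mod_cast hn
  have hn0 : (0 : ℝ) < n := by linarith
  rw [ex_wired hp hs hac hn hsi π R (fun ω => settled ω (gates s) x H)
    (fun a ω q => settled_congr (fun v hv =>
      Function.update_of_ne (ne_of_mem_of_not_mem (mem_gates s a) hv).symm _ _) x H)
    (fun a ω => settled_of_mem (mem_gates s a))]
  have hc0 := probNonCanalyzing_nonneg hp
  refine mul_le_mul_of_nonneg_left ?_ (by positivity)
  have h1 : ∀ ω : Net n, ((1 / (n : ℝ)) * (1 - unk (settled ω (gates s) x H) / n)) ^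
      Fintype.card ι ≤ ((n - unk (settled ω (gates s) x H)) / (n * (n - 1))) ^ Fintype.card ι := by
    intro ω
    have hu := unk_le (settled ω (gates s) x H)
    have h2 : (1 / (n : ℝ)) * (1 - unk (settled ω (gates s) x H) / n) =
        (n - unk (settled ω (gates s) x H)) / (n * n) := by field_simp
    rw [h2]
    apply pow_le_pow_left₀ (div_nonneg (by linarith) (by positivity))
    apply div_le_div_of_nonneg_left (by linarith)
    · exact mul_pos hn0 (by linarith)
    · exact mul_le_mul_of_nonneg_left (by linarith) hn0.le
  refine le_trans ?_ (ex_mono hp h1)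
  simp_rw [mul_pow]
  rw [ex_mul_left]
  refine mul_le_mul_of_nonneg_left ?_ (by positivity)
  refine le_trans ?_ (ex_pow_le hp hn (fun ω => ?_) _)
  · apply pow_le_pow_left₀ (by linarith)
    rw [ex_sub, ex_const hp hn]
    have : ex p (fun ω => unk (settled ω (gates s) x H) / n) =
        ex p (fun ω => unk (settled ω (gates s) x H)) / n := by
      rw [div_eq_inv_mul, ← ex_mul_left]
      congr 1; funext ω; ring
    linarith
  · have := (div_le_one hn0).2 (unk_le (settled ω (gates s) x H))
    linarith

end Wired

end RBCA

namespace RBCA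

/-! ### Signed rotations -/

section Rotation

variable {ℓ : ℕ}

/-- The sign collected by `j` steps that end at `a`. -/
def signSum (sg : ZMod ℓ → Bool) : ℕ → ZMod ℓ → Bool
  | 0 => fun _ => false
  | j + 1 => fun a => xor (signSum sg j (a - 1)) (sg a)

theorem rotate_add {H : ℕ} {z : ℕ → ZMod ℓ → Bool} {sg : ZMod ℓ → Bool}
    (hz : ∀ t, H ≤ t → ∀ a, z (t + 1) a = xor (z t (a - 1)) (sg a)) {t : ℕ} (ht : H ≤ t) (j : ℕ)
    (a : ZMod ℓ) : z (t + j) a = xor (z t (a - j)) (signSum sg j a) := by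
  induction j generalizing a with
  | zero => simp [signSum]
  | succ j ih =>
    rw [← add_assoc, hz _ (by omega), ih]
    have : a - 1 - (j : ZMod ℓ) = a - ((j + 1 : ℕ) : ZMod ℓ) := by push_cast; ring
    rw [this, signSum, Bool.xor_assoc]

theorem rotate_full {H : ℕ} {z : ℕ → ZMod ℓ → Bool} {sg : ZMod ℓ → Bool}
    (hz : ∀ t, H ≤ t → ∀ a, z (t + 1) a = xor (z t (a - 1)) (sg a)) {t : ℕ} (ht : H ≤ t)
    (a : ZMod ℓ) : z (t + ℓ) a = xor (z t a) (signSum sg ℓ a) := by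
  rw [rotate_add hz ht]; simp

theorem rotate_full_twice {H : ℕ} {z : ℕ → ZMod ℓ → Bool} {sg : ZMod ℓ → Bool}
    (hz : ∀ t, H ≤ t → ∀ a, z (t + 1) a = xor (z t (a - 1)) (sg a)) {t : ℕ} (ht : H ≤ t)
    (a : ZMod ℓ) : z (t + 2 * ℓ) a = z t a := by
  rw [two_mul, ← add_assoc, rotate_full hz (by omega), rotate_full hz ht]
  simp

theorem val_sub_one_of_ne [NeZero ℓ] (hℓ : 2 ≤ ℓ) {a : ZMod ℓ} (ha : a ≠ 0) :
    (a - 1).val = a.val - 1 := by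
  have h1 : (1 : ZMod ℓ).val = 1 := ZMod.val_one'' (by omega)
  have h2 : a.val ≠ 0 := fun h => ha ((ZMod.val_eq_zero a).1 h)
  rw [ZMod.val_sub (by omega), h1]

theorem val_zero_sub_one [NeZero ℓ] (hℓ : 2 ≤ ℓ) : ((0 : ZMod ℓ) - 1).val = ℓ - 1 := by
  have h1 : (1 : ZMod ℓ).val = 1 := ZMod.val_one'' (by omega)
  have h0 : (1 : ZMod ℓ) ≠ 0 := fun h => by rw [h] at h1; simp at h1
  have : NeZero (1 : ZMod ℓ) := ⟨h0⟩
  rw [zero_sub, ZMod.val_neg_of_ne_zero, h1]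

/-- At most one revolution ending at `a` passes position 0 at most once, namely if `a.val < j`. -/
theorem signSum_flip [NeZero ℓ] (hℓ : 2 ≤ ℓ) (sg : ZMod ℓ → Bool) (e : Bool) {j : ℕ} (hj : j ≤ ℓ)
    (a : ZMod ℓ) : signSum (fun a => xor (e && decide (a = 0)) (sg a)) j a =
      xor (e && decide (a.val < j)) (signSum sg j a) := by
  induction j generalizing a with
  | zero => simp [signSum]
  | succ j ih =>
    simp only [signSum]
    rw [ih (by omega)]
    by_cases ha : a = 0
    · subst ha
      rw [val_zero_sub_one hℓ]
      have h1 : decide (ℓ - 1 < j) = false := by simp; omega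
      have h2 : decide ((0 : ZMod ℓ).val < j + 1) = true := by simp
      rw [h1, h2]
      simp [Bool.xor_left_comm]
    · rw [val_sub_one_of_ne hℓ ha]
      have h0 : a.val ≠ 0 := fun h => ha ((ZMod.val_eq_zero a).1 h)
      have h1 : decide (a.val - 1 < j) = decide (a.val < j + 1) := by
        congr 1; apply propext; omega
      rw [h1]
      simp [ha]

/-- Negating the output at the root of a cycle toggles the degeneracy of the orbit. -/
theorem rotate_flip [NeZero ℓ] {H : ℕ} (hH : 1 ≤ H) (hHℓ : H + 1 ≤ ℓ) {z z' : ℕ → ZMod ℓ → Bool}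
    {g : ZMod ℓ → ℕ → Bool → Bool} {sg : ZMod ℓ → Bool} (e : Bool)
    (hg : ∀ a t b, H ≤ t → g a t b = xor b (sg a)) (h0 : z' 0 = z 0)
    (hz : ∀ t a, z (t + 1) a = g a t (z t (a - 1)))
    (hz' : ∀ t a, z' (t + 1) a = xor (e && decide (a = 0)) (g a t (z' t (a - 1)))) :
    (z' (H + 1) 0 ≠ z' (H + ℓ) 0) ↔ (xor e (decide (z (H + 1) 0 ≠ z (H + ℓ) 0)) = true) := by
  have hℓ : 2 ≤ ℓ := by omega
  -- The change at position 0 has not yet travelled as far as `a`.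
  have early : ∀ t (a : ZMod ℓ), t ≤ a.val → z' t a = z t a := by
    intro t
    induction t with
    | zero => intro a _; rw [h0]
    | succ t ih =>
      intro a ha
      have ha0 : a ≠ 0 := by rintro rfl; simp at ha
      rw [hz, hz', ih _ (by rw [val_sub_one_of_ne hℓ ha0]; omega)]
      simp [ha0]
  have root : ∀ t, t + 1 ≤ ℓ → z' (t + 1) 0 = xor e (z (t + 1) 0) := by
    intro t ht
    rw [hz, hz', early t _ (by rw [val_zero_sub_one hℓ]; omega)]
    simp
  have r1 := root H hHℓ
  have r0 : z' H 0 = xor e (z H 0) := by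
    have := root (H - 1) (by omega)
    rwa [Nat.sub_add_cancel hH] at this
  have f : z (H + ℓ) 0 = xor (z H 0) (signSum sg ℓ 0) :=
    rotate_full (H := H) (fun t ht a => by rw [hz, hg _ _ _ ht]) le_rfl 0
  have f' : z' (H + ℓ) 0 =
      xor (z' H 0) (signSum (fun a => xor (e && decide (a = 0)) (sg a)) ℓ 0) :=
    rotate_full (H := H) (fun t ht a => by
      rw [hz', hg _ _ _ ht, Bool.xor_left_comm]) le_rfl 0
  -- At time `H + ℓ` the change has acted twice and cancels, while at time `H + 1` it has acted
  -- once; hence exactly one side of the comparison flips.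
  rw [signSum_flip hℓ sg e le_rfl] at f'
  have h2 : decide ((0 : ZMod ℓ).val < ℓ) = true := by simp; omega
  rw [h2, r0] at f'
  rw [r1, f', f]
  generalize z (H + 1) 0 = A
  generalize z H 0 = B
  generalize signSum sg ℓ 0 = C
  cases e <;> cases A <;> cases B <;> cases C <;> simp

end Rotation

/-! ### The size of the state cycle is a period -/

namespace Automaton

variable {n : ℕ} (B : Automaton n)

theorem state_add_of_eq {s t : ℕ} (h : B.state s = B.state t) (j : ℕ) :
    B.state (s + j) = B.state (t + j) := by
  have key : ∀ u, B.state (u + j) = B.step^[j] (B.state u) := by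
    intro u
    rw [state, state, add_comm, Function.iterate_add_apply]
  rw [key, key, h]

/-- The state cycle is the injective image of the times from `cycleEntry` up to, but excluding,
`firstRepeat`. -/
theorem cycleSize_spec :
    ∃ t₀, 0 < B.cycleSize ∧ ∀ t, t₀ ≤ t → B.state (t + B.cycleSize) = B.state t := by
  classical
  obtain ⟨hlt, heq⟩ : B.cycleEntry < B.firstRepeat ∧ B.state B.cycleEntry = B.state B.firstRepeat :=
    Nat.find_spec B.exists_entry
  have hper : ∀ t, B.cycleEntry ≤ t →
      B.state (t + (B.firstRepeat - B.cycleEntry)) = B.state t := by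
    intro t ht
    have := B.state_add_of_eq heq (t - B.cycleEntry)
    rw [Nat.add_sub_cancel' ht] at this
    rw [this]
    congr 1
    omega
  have hset : B.stateCycle =
      (Finset.image B.state (Finset.Ico B.cycleEntry B.firstRepeat) : Set (Fin n → Bool)) := by
    ext y
    simp only [stateCycle, Set.mem_ofPred_eq, Finset.coe_image, Set.mem_image, Finset.coe_Ico,
      Set.mem_Ico]
    constructor
    · rintro ⟨t, ht, rfl⟩
      induction t using Nat.strong_induction_on with
      | _ t ih =>
        by_cases h : t < B.firstRepeat
        · exact ⟨t, ⟨ht, h⟩, rfl⟩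
        · obtain ⟨s, hs, hs'⟩ := ih (t - (B.firstRepeat - B.cycleEntry)) (by omega) (by omega)
          refine ⟨s, hs, hs'.trans ?_⟩
          rw [← hper _ (by omega : B.cycleEntry ≤ t - (B.firstRepeat - B.cycleEntry))]
          congr 1
          omega
    · rintro ⟨t, ht, rfl⟩
      exact ⟨t, ht.1, rfl⟩
  have hinj : Set.InjOn B.state (Finset.Ico B.cycleEntry B.firstRepeat : Finset ℕ) := by
    have hno : ∀ s t, s < t → t < B.firstRepeat → B.state s ≠ B.state t :=
      fun s t hst ht h => Nat.find_min B.exists_repeat ht ⟨s, hst, h⟩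
    intro s hs t ht h
    simp only [Finset.coe_Ico, Set.mem_Ico] at hs ht
    rcases lt_trichotomy s t with hst | hst | hst
    · exact absurd h (hno s t hst ht.2)
    · exact hst
    · exact absurd h.symm (hno t s hst hs.2)
  have hcard : B.cycleSize = B.firstRepeat - B.cycleEntry := by
    rw [cycleSize, hset, Set.ncard_coe_finset, Finset.card_image_of_injOn hinj, Nat.card_Ico]
  exact ⟨B.cycleEntry, by omega, fun t ht => by rw [hcard]; exact hper t ht⟩

/-- A gate whose orbit has period `2 * ℓ` but is not degenerate forces `ℓ` to divide the size of
the state cycle. -/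
theorem dvd_cycleSize {ℓ H : ℕ} (hℓ : ℓ.Prime) (hodd : Odd ℓ) (v : Fin n)
    (hper : ∀ t, H ≤ t → B.state (t + 2 * ℓ) v = B.state t v)
    (hnd : B.state (H + 1) v ≠ B.state (H + ℓ) v) : ℓ ∣ B.cycleSize := by
  by_contra hdvd
  apply hnd
  obtain ⟨t₀, -, ht₀⟩ := B.cycleSize_spec
  obtain ⟨s, hs⟩ := hodd
  -- With `y` inverse to the cycle size modulo ℓ = 2s + 1, the multiple `2 * s * y` of the cycle
  -- size is ℓ - 1 modulo 2ℓ, which is the distance between the two compared times.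
  obtain ⟨y, -, hy⟩ := Nat.exists_mul_mod_eq_one_of_coprime
    ((hℓ.coprime_iff_not_dvd.2 hdvd).symm) hℓ.one_lt
  have hperk : ∀ k t, H ≤ t → B.state (t + 2 * ℓ * k) v = B.state t v := by
    intro k
    induction k with
    | zero => intro t _; simp
    | succ k ih =>
      intro t ht
      rw [mul_add, mul_one, ← add_assoc, hper _ (by omega), ih t ht]
  have hCk : ∀ k t, t₀ ≤ t → B.state (t + B.cycleSize * k) = B.state t := by
    intro k
    induction k with
    | zero => intro t _; simp
    | succ k ih =>
      intro t ht
      rw [mul_add, mul_one, ← add_assoc, ht₀ _ (by omega), ih t ht]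
  have hdiv := Nat.div_add_mod (B.cycleSize * y) ℓ
  rw [hy] at hdiv
  set m := B.cycleSize * y / ℓ
  -- Adding full periods of the gate passes the transient part of the whole automaton.
  have hbig : t₀ ≤ H + 1 + 2 * ℓ * t₀ := by nlinarith [hℓ.pos]
  calc B.state (H + 1) v = B.state (H + 1 + 2 * ℓ * t₀) v := (hperk _ _ (by omega)).symm
    _ = B.state (H + 1 + 2 * ℓ * t₀ + B.cycleSize * (2 * s * y)) v := by rw [hCk _ _ hbig]
    _ = B.state (H + ℓ + 2 * ℓ * (t₀ + s * m)) v := by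
        congr 1
        have : B.cycleSize * (2 * s * y) = 2 * s * (B.cycleSize * y) := by ring
        rw [this, ← hdiv]
        nlinarith
    _ = B.state (H + ℓ) v := hperk _ _ (by omega)

end Automaton

end RBCA

namespace RBCA

variable {p : BoolFn → ℝ} {n : ℕ}

/-! ### The dynamics of wired cycles -/

/-- Before time `H` the value comes from the simulation of `x`, afterwards from the one without
knowledge; neither reads the gates in `Z`. -/
theorem settled_state {ω ω' : Net n} {Z : Finset (Fin n)} (h : ∀ v, v ∉ Z → ω v = ω' v)
    {x : Fin n → Bool} {H : ℕ} {o : Fin n} {w : Bool} (hw : settled ω Z x H o = some w) (t : ℕ) :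
    (aut ω' x).state t o = (aut ω x).state t o ∧ (H ≤ t → (aut ω x).state t o = w) := by
  have hw1 : krun ω Z unknown H o = some w := settled_le ω Z x H o w hw
  have hw2 : krun ω' Z unknown H o = some w := by rw [← krun_congr h]; exact hw1
  refine ⟨?_, fun ht => krun_unknown_sound ω x Z hw1 ht⟩
  rcases lt_or_ge t H with ht | ht
  · obtain ⟨b, hb⟩ := Option.ne_none_iff_exists'.1 (settled_known hw ht)
    rw [krun_known_sound ω x Z hb, krun_known_sound ω' x Z (by rw [← krun_congr h]; exact hb)]
  · rw [krun_unknown_sound ω x Z hw1 ht, krun_unknown_sound ω' x Z hw2 ht]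

/-- A fed gate is driven by its feeding gate and by the settled gates only, also after changes of
the gates in `Z`. -/
theorem feeds_step {ω : Net n} {Z : Finset (Fin n)} {x : Fin n → Bool} {H : ℕ} {u v : Fin n}
    (hf : Feeds (ω u) v (settled ω Z x H)) :
    ∃ (g : ℕ → Bool → Bool) (sg : Bool), (∀ t b, H ≤ t → g t b = xor b sg) ∧
      ∀ (ω' : Net n) (e : Bool), (∀ v, v ∉ Z → ω v = ω' v) → (ω' u).1 = (ω u).1 →
        (∀ a b, (ω' u).2 a b = xor e ((ω u).2 a b)) →
        ∀ t, (aut ω' x).state (t + 1) u = xor e (g t ((aut ω' x).state t v)) := by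
  rcases hf with ⟨h1, w, hw, hne⟩ | ⟨h1, w, hw, hne⟩
  · refine ⟨fun t b => (ω u).2 b ((aut ω x).state t (ω u).1.1.2), (ω u).2 false w, ?_, ?_⟩
    · intro t b ht
      simp only [(settled_state (fun _ _ => rfl) hw t).2 ht]
      cases b
      · simp
      · revert hne
        cases (ω u).2 false w <;> cases (ω u).2 true w <;> simp
    · intro ω' e hZ hin hfn t
      rw [state_succ, hin, hfn, (settled_state hZ hw t).1, h1]
  · refine ⟨fun t b => (ω u).2 ((aut ω x).state t (ω u).1.1.1) b, (ω u).2 w false, ?_, ?_⟩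
    · intro t b ht
      simp only [(settled_state (fun _ _ => rfl) hw t).2 ht]
      cases b
      · simp
      · revert hne
        cases (ω u).2 w false <;> cases (ω u).2 w true <;> simp
    · intro ω' e hZ hin hfn t
      rw [state_succ, hin, hfn, (settled_state hZ hw t).1, h1]

/-- Negation of the non-canalyzing functions at the gates in `R`. -/
def flipAt (R : Finset (Fin n)) (ω : Net n) : Net n :=
  fun v => if v ∈ R then ((ω v).1, (ω v).2.negC) else ω v

theorem flipAt_flipAt (R : Finset (Fin n)) (ω : Net n) : flipAt R (flipAt R ω) = ω := by
  funext v
  by_cases hv : v ∈ R <;> simp [flipAt, hv, BoolFn.negC_negC]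

theorem ex_flipAt (hs : IsSymmetric p) (R : Finset (Fin n)) (g : Net n → ℝ) :
    ex p (fun ω => g (flipAt R ω)) = ex p g := by
  unfold ex
  rw [← Equiv.sum_comp ⟨flipAt R, flipAt R, flipAt_flipAt R, flipAt_flipAt R⟩]
  refine Finset.sum_congr rfl fun ω _ => ?_
  simp only [Equiv.coe_fn_mk, flipAt_flipAt]
  congr 1
  refine Finset.prod_congr rfl fun i _ => ?_
  by_cases hi : i ∈ R <;> simp [flipAt, hi, gateWeight, hs.negC]

theorem flipAt_of_notMem {R : Finset (Fin n)} {v : Fin n} (hv : v ∉ R) (ω : Net n) :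
    flipAt R ω v = ω v := by simp [flipAt, hv]

theorem negC_sens : ∀ (f : BoolFn) (w : Bool),
    ((f.negC false w ≠ f.negC true w) ↔ (f false w ≠ f true w)) ∧
    ((f.negC w false ≠ f.negC w true) ↔ (f w false ≠ f w true)) := by decide

theorem feeds_flipAt (R : Finset (Fin n)) (ω : Net n) (v u : Fin n) (τ : Fin n → Option Bool) :
    Feeds (flipAt R ω v) u τ ↔ Feeds (ω v) u τ := by
  by_cases hv : v ∈ R
  · simp only [Feeds, flipAt, if_pos hv, (negC_sens _ _).1, (negC_sens _ _).2]
  · rw [flipAt_of_notMem hv]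

theorem classC_flipAt (R : Finset (Fin n)) (ω : Net n) (v : Fin n) :
    (flipAt R ω v).2.ClassC ↔ (ω v).2.ClassC := by
  by_cases hv : v ∈ R
  · simp only [flipAt, if_pos hv]; exact BoolFn.classC_negC _
  · rw [flipAt_of_notMem hv]

/-! ### Families of disjoint cycles and negations at their roots -/

section Cycles

variable {κ : Type*} {len : κ → ℕ}

/-- The positions in a family of cycles of the lengths `len i`. -/
abbrev Pos (len : κ → ℕ) : Type _ := Σ i, ZMod (len i)

/-- The preceding position on the same cycle. -/
def before (a : Pos len) : Pos len := ⟨a.1, a.2 - 1⟩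

/-- The first position of a cycle. -/
def root (len : κ → ℕ) (i : κ) : Pos len := ⟨i, 0⟩

/-- The gates at the first positions of the cycles in `A`. -/
def rootGates (s : Pos len → Fin n) (A : Finset κ) : Finset (Fin n) :=
  A.image fun i => s (root len i)

theorem mem_rootGates {s : Pos len → Fin n} (hs : Function.Injective s) (A : Finset κ)
    (a : Pos len) : s a ∈ rootGates s A ↔ a.1 ∈ A ∧ a.2 = 0 := by
  constructor
  · intro h
    obtain ⟨i, hi, hia⟩ := Finset.mem_image.1 h
    have := hs hia
    subst this
    exact ⟨hi, rfl⟩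
  · rintro ⟨h1, h2⟩
    obtain ⟨i, b⟩ := a
    dsimp only at h1 h2
    rw [h2]
    exact Finset.mem_image_of_mem (fun i => s (root len i)) h1

variable [Fintype κ]

/-- The first positions of all cycles. -/
def roots (len : κ → ℕ) : Finset (Pos len) := Finset.univ.map ⟨root len, fun i j h => by
  simpa [root] using congrArg Sigma.fst h⟩

theorem card_roots : (roots len).card = Fintype.card κ := by simp [roots]

variable [DecidableEq κ] [∀ i, NeZero (len i)]

/-- The gates `s` form cycles that rotate their states up to signs once all other inputs are
constant, and the first gates have non-canalyzing functions. -/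
def Rotating (ω : Net n) (s : Pos len → Fin n) (x : Fin n → Bool) (H : ℕ) : Prop :=
  Wired ω s before (settled ω (gates s) x H) ∧ ∀ a ∈ roots len, (ω (s a)).2.ClassC

/-- The orbit of the first gate of a cycle is not degenerate. -/
def Nondeg (ω : Net n) (s : Pos len → Fin n) (x : Fin n → Bool) (H : ℕ) (i : κ) : Prop :=
  (aut ω x).state (H + 1) (s (root len i)) ≠ (aut ω x).state (H + len i) (s (root len i))

theorem rootGates_subset (s : Pos len → Fin n) (A : Finset κ) : rootGates s A ⊆ gates s := by
  intro v hv
  obtain ⟨i, -, rfl⟩ := Finset.mem_image.1 hv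
  exact mem_gates s _

theorem flipAt_off {s : Pos len → Fin n} (A : Finset κ) (ω : Net n) :
    ∀ v, v ∉ gates s → ω v = flipAt (rootGates s A) ω v :=
  fun _ hv => (flipAt_of_notMem (fun h => hv (rootGates_subset s A h)) ω).symm

theorem rotating_flipAt {s : Pos len → Fin n} (A : Finset κ) (ω : Net n) (x : Fin n → Bool)
    (H : ℕ) : Rotating (flipAt (rootGates s A) ω) s x H ↔ Rotating ω s x H := by
  unfold Rotating Wired
  rw [← settled_congr (flipAt_off A ω) x H]
  simp only [feeds_flipAt, classC_flipAt]

theorem nondeg_flipAt {s : Pos len → Fin n} (hsi : Function.Injective s) {ω : Net n}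
    {x : Fin n → Bool} {H : ℕ} (h : Rotating ω s x H) (hH : 1 ≤ H) (A : Finset κ) (i : κ)
    (hHl : H + 1 ≤ len i) : Nondeg (flipAt (rootGates s A) ω) s x H i ↔
      (xor (decide (i ∈ A)) (decide ((aut ω x).state (H + 1) (s (root len i)) ≠
        (aut ω x).state (H + len i) (s (root len i)))) = true) := by
  obtain ⟨hw, hC⟩ := h
  choose g sg hg hstep using fun b : ZMod (len i) => feeds_step (hw ⟨i, b⟩)
  refine rotate_flip (ℓ := len i) hH hHl (z := fun t b => (aut ω x).state t (s ⟨i, b⟩))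
    (z' := fun t b => (aut (flipAt (rootGates s A) ω) x).state t (s ⟨i, b⟩))
    (decide (i ∈ A)) hg rfl (fun t b => ?_) (fun t b => ?_)
  · have := hstep b ω false (fun _ _ => rfl) rfl (fun _ _ => by simp) t
    rwa [Bool.false_xor] at this
  · refine hstep b _ _ (flipAt_off A ω) ?_ ?_ t
    · simp only [flipAt]; split_ifs <;> rfl
    · intro c d
      have hm := mem_rootGates hsi A ⟨i, b⟩
      dsimp only at hm
      by_cases hb : s ⟨i, b⟩ ∈ rootGates s A
      · have hb' := hm.1 hb
        have hCb : (ω (s ⟨i, b⟩)).2.ClassC := by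
          obtain ⟨_, h2⟩ := hb'
          rw [h2]
          exact hC _ (Finset.mem_map_of_mem _ (Finset.mem_univ i))
        have he : (decide (i ∈ A) && decide (b = 0)) = true := by
          rw [← Bool.decide_and, decide_eq_true_iff]
          exact hb'
        rw [he, Bool.true_xor, ← BoolFn.negC_apply hCb]
        simp only [flipAt, if_pos hb]
      · have : (decide (i ∈ A) && decide (b = 0)) = false := by
          rw [← Bool.decide_and, decide_eq_false_iff_not]
          exact fun h' => hb (hm.2 h')
        rw [flipAt_of_notMem hb, this, Bool.false_xor]

/-- Negations at the roots preserve the measure and the wiring, and some choice among the 2^k sets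
of roots makes all orbits nondegenerate. -/
theorem ex_rotating_le (hp : IsDistribution p) (hs : IsSymmetric p) {s : Pos len → Fin n}
    (hsi : Function.Injective s) (x : Fin n → Bool) {H : ℕ} (hH : 1 ≤ H)
    (hHl : ∀ i, H + 1 ≤ len i) :
    ex p (fun ω => ind (Rotating ω s x H)) ≤ 2 ^ Fintype.card κ *
      ex p fun ω => ind (Rotating ω s x H ∧ ∀ i, Nondeg ω s x H i) := by
  have h1 : ∑ A : Finset κ, ex p (fun ω : Net n =>
      ind (Rotating (flipAt (rootGates s A) ω) s x H ∧
        ∀ i, Nondeg (flipAt (rootGates s A) ω) s x H i)) =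
      2 ^ Fintype.card κ * ex p fun ω => ind (Rotating ω s x H ∧ ∀ i, Nondeg ω s x H i) := by
    rw [Finset.sum_congr rfl fun A _ => ex_flipAt hs (rootGates s A)
      fun ω => ind (Rotating ω s x H ∧ ∀ i, Nondeg ω s x H i)]
    simp
  rw [← h1, ← ex_sum]
  refine ex_mono hp fun ω => ?_
  by_cases hR : Rotating ω s x H
  · classical
    have hsum := Finset.single_le_sum (f := fun A : Finset κ =>
      ind (Rotating (flipAt (rootGates s A) ω) s x H ∧
        ∀ i, Nondeg (flipAt (rootGates s A) ω) s x H i)) (fun A _ => ind_nonneg _)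
      -- The right choice is to negate the roots of exactly the degenerate cycles.
      (Finset.mem_univ (Finset.univ.filter fun i => ¬ Nondeg ω s x H i))
    refine le_trans ?_ hsum
    rw [ind_pos hR]
    refine le_of_eq (ind_pos ⟨(rotating_flipAt _ ω x H).2 hR, fun i => ?_⟩).symm
    rw [nondeg_flipAt hsi hR hH _ i (hHl i)]
    by_cases hi : Nondeg ω s x H i
    · have hi' := hi
      unfold Nondeg at hi'
      simp [hi, hi']
    · have hi' := hi
      unfold Nondeg at hi'
      simp only [ne_eq, not_not] at hi'
      simp [hi, hi']
  · rw [ind_neg hR]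
    exact Finset.sum_nonneg fun A _ => ind_nonneg _

theorem Rotating.dvd_cycleSize {s : Pos len → Fin n} {ω : Net n} {x : Fin n → Bool} {H : ℕ}
    (h : Rotating ω s x H) {i : κ} (hi : Nondeg ω s x H i) (hl : (len i).Prime)
    (hodd : Odd (len i)) : len i ∣ (aut ω x).cycleSize := by
  choose g sg hg hstep using fun b : ZMod (len i) => feeds_step (h.1 ⟨i, b⟩)
  refine (aut ω x).dvd_cycleSize hl hodd (s (root len i)) (fun t ht => ?_) hi
  refine rotate_full_twice (H := H) (z := fun t b => (aut ω x).state t (s ⟨i, b⟩)) (sg := sg)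
    (fun t ht b => ?_) ht 0
  have := hstep b ω false (fun _ _ => rfl) rfl (fun _ _ => by simp) t
  simp only [Bool.false_xor] at this
  rw [this, hg b t _ ht]
  rfl

end Cycles

end RBCA

namespace RBCA

variable {p : BoolFn → ℝ} {n : ℕ}

/-! ### The second moment of the number of families of cycles -/

theorem Feeds.mono {q : Gate n} {u : Fin n} {τ τ' : Fin n → Option Bool} (h : Feeds q u τ)
    (hτ : ∀ v, InfoLE (τ v) (τ' v)) : Feeds q u τ' := by
  rcases h with ⟨h1, w, hw, hne⟩ | ⟨h1, w, hw, hne⟩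
  · exact Or.inl ⟨h1, w, hτ _ w hw, hne⟩
  · exact Or.inr ⟨h1, w, hτ _ w hw, hne⟩

theorem keval_none_fst {f : BoolFn} {w : Bool} (h : f false w ≠ f true w) {b : Option Bool}
    (hb : InfoLE b (some w)) : keval f none b = none := by
  revert f w b; decide

theorem keval_none_snd {f : BoolFn} {w : Bool} (h : f w false ≠ f w true) {a : Option Bool}
    (ha : InfoLE a (some w)) : keval f a none = none := by
  revert f w a; decide

/-- A function sensitive to `u` at the value `w` of the other input cannot be determined from less
information when `u` is unknown. -/
theorem Feeds.keval_eq_none {q : Gate n} {u : Fin n} {τ τ' : Fin n → Option Bool}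
    (h : Feeds q u τ) (hτ : ∀ v, InfoLE (τ' v) (τ v)) (hu : τ' u = none) :
    keval q.2 (τ' q.1.1.1) (τ' q.1.1.2) = none := by
  rcases h with ⟨h1, w, hw, hne⟩ | ⟨h1, w, hw, hne⟩
  · rw [h1, hu]
    exact keval_none_fst hne (hw ▸ hτ _)
  · rw [h1, hu]
    exact keval_none_snd hne (hw ▸ hτ _)

theorem Feeds.unique {q : Gate n} {u u' : Fin n} {τ : Fin n → Option Bool} (h : Feeds q u τ)
    (h' : Feeds q u' τ) (hu' : τ u' = none) : u = u' := by
  rcases h with ⟨h1, w, hw, -⟩ | ⟨h1, w, hw, -⟩ <;>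
  rcases h' with ⟨h1', w', hw', -⟩ | ⟨h1', w', hw', -⟩
  · exact h1.symm.trans h1'
  · rw [← h1', hw] at hu'; simp at hu'
  · rw [← h1', hw] at hu'; simp at hu'
  · exact h1.symm.trans h1'

/-- Each gate `s a` copies or negates the gate `s (π a)`, given the values found in `H` steps. -/
def Fed {ι : Type*} (ω : Net n) (H : ℕ) (s : ι → Fin n) (π : ι → ι) : Prop :=
  ∀ a, Feeds (ω (s a)) (s (π a)) (krun ω ∅ unknown H)

section Fed

variable {ι ι' : Type*} {ω : Net n} {H : ℕ} {s : ι → Fin n} {π : ι → ι}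

/-- Each gate waits for its feeder in the same family, so none of them ever obtains a value. -/
theorem Fed.krun_eq_none (h : Fed ω H s π) {t : ℕ} (ht : t ≤ H) (a : ι) :
    krun ω ∅ unknown t (s a) = none := by
  induction t generalizing a with
  | zero => simp [krun]
  | succ t ih =>
    rw [krun_succ (by simp)]
    exact (h a).keval_eq_none (fun v => krun_unknown_mono ω ∅ (by omega) v) (ih (by omega) _)

theorem krun_clamp {Z : Finset (Fin n)} (h : ∀ t ≤ H, ∀ v ∈ Z, krun ω ∅ unknown t v = none)
    {t : ℕ} (ht : t ≤ H) : krun ω Z unknown t = krun ω ∅ unknown t := by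
  induction t with
  | zero => funext v; simp [krun]
  | succ t ih =>
    funext v
    by_cases hv : v ∈ Z
    · rw [krun_of_mem hv, h _ ht v hv]
    · rw [krun_succ hv, krun_succ (by simp), ih (by omega)]

/-- Clamping gates that stay undetermined anyway changes nothing. Thus `Fed`, which does not mention
clamping and so can compare different families, still allows the independence argument. -/
theorem Fed.wired [Fintype ι] [DecidableEq ι] (h : Fed ω H s π) :
    Wired ω s π (krun ω (gates s) unknown H) := by
  rw [krun_clamp (fun t ht v hv => ?_) le_rfl]
  · exact h
  · obtain ⟨a, -, rfl⟩ := Finset.mem_image.1 hv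
    exact h.krun_eq_none ht a

/-- The feeder is the only undetermined input, so it is determined by the gate; families that share
a gate agree from there backwards. -/
theorem Fed.before_eq {s' : ι' → Fin n} {π' : ι' → ι'} (h : Fed ω H s π) (h' : Fed ω H s' π')
    {a : ι} {b : ι'} (hab : s a = s' b) : s (π a) = s' (π' b) :=
  (h a).unique (hab ▸ h' b) (h'.krun_eq_none le_rfl _)

theorem Fed.iterate_eq {s' : ι' → Fin n} {π' : ι' → ι'} (h : Fed ω H s π) (h' : Fed ω H s' π')
    {a : ι} {b : ι'} (hab : s a = s' b) (j : ℕ) : s (π^[j] a) = s' (π'^[j] b) := by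
  induction j with
  | zero => exact hab
  | succ j ih =>
    rw [Function.iterate_succ_apply', Function.iterate_succ_apply']
    exact h.before_eq h' ih

theorem card_embedding_le_pow (ι : Type*) [Fintype ι] (n : ℕ) :
    (Fintype.card (ι ↪ Fin n) : ℝ) ≤ (n : ℝ) ^ Fintype.card ι := by
  rw [Fintype.card_embedding_eq, Fintype.card_fin]
  exact_mod_cast Nat.descFactorial_le_pow n _

/-- At most n^m placements, each of probability at most n^(-m). The map `π` is arbitrary, so the
bound also applies to joined families. -/
theorem ex_sum_fed_le [Fintype ι] (hp : IsDistribution p) (hs : IsSymmetric p)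
    (hac : probConstant p = probNonCanalyzing p) (hn : 2 ≤ n) (π : ι → ι) (H : ℕ) :
    ex p (fun ω : Net n => ∑ s : ι ↪ Fin n, ind (Fed ω H s π)) ≤ 1 := by
  classical
  rw [ex_sum]
  have h1 : ∀ s : ι ↪ Fin n, ex p (fun ω => ind (Fed ω H s π)) ≤ (1 / (n : ℝ)) ^ Fintype.card ι :=
    fun s => (ex_mono hp fun ω => ind_mono Fed.wired).trans
      (ex_wired_le hp hs hac hn s.injective π H)
  refine (Finset.sum_le_sum fun s _ => h1 s).trans ?_
  rw [Finset.sum_const, Finset.card_univ, nsmul_eq_mul]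
  have hn0 : (0 : ℝ) < n := by have : (2 : ℝ) ≤ n := by exact_mod_cast hn
                               linarith
  refine (mul_le_mul_of_nonneg_right (card_embedding_le_pow ι n) (by positivity)).trans ?_
  rw [← mul_pow, mul_one_div_cancel hn0.ne', one_pow]

end Fed

theorem sum_ind {α : Type*} [Fintype α] (P : α → Prop) : ∑ z, ind (P z) = Nat.card {z // P z} := by
  classical
  simp only [ind_eq_ite]
  rw [Finset.sum_boole, Nat.card_eq_fintype_card, Fintype.card_subtype]

/-! ### Pairs of families that may overlap -/

section Cycles

variable {κ : Type*} {len : κ → ℕ}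

theorem iterate_before (a : Pos len) (j : ℕ) : before^[j] a = ⟨a.1, a.2 - j⟩ := by
  induction j with
  | zero => simp
  | succ j ih =>
    rw [Function.iterate_succ_apply', ih]
    simp only [before, Nat.cast_add, Nat.cast_one, sub_sub]

/-- The positions on the cycles `i` with `g i = none`. -/
abbrev OffPos (g : κ → Option (Pos len)) : Type _ := {a : Pos len // g a.1 = none}

/-- The preceding position. -/
def beforeOff (g : κ → Option (Pos len)) (a : OffPos g) : OffPos g := ⟨before a.1, a.2⟩

/-- `g` locates the first gates of the cycles `s'` on the cycles `s`. -/
def Located (g : κ → Option (Pos len)) (s s' : Pos len → Fin n) : Prop :=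
  ∀ i, (∀ a, g i = some a → s a = s' (root len i)) ∧
    (g i = none → ∀ a, s a ≠ s' (root len i))

theorem exists_located (s s' : Pos len → Fin n) : ∃ g, Located g s s' := by
  classical
  refine ⟨fun i => if h : ∃ a, s a = s' (root len i) then some h.choose else none, fun i => ?_⟩
  by_cases h : ∃ a, s a = s' (root len i)
  · simp only [dif_pos h]
    refine ⟨fun a ha => ?_, fun h' => by simp at h'⟩
    have := h.choose_spec
    rwa [Option.some.inj ha] at this
  · simp only [dif_neg h]
    exact ⟨fun a ha => by simp at ha, fun _ a ha => h ⟨a, ha⟩⟩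

variable [∀ i, NeZero (len i)]

theorem exists_iterate_root (a : Pos len) : ∃ j, before^[j] a = root len a.1 :=
  ⟨a.2.val, by rw [iterate_before]; simp [root]⟩

theorem exists_iterate_of_root (a : Pos len) : ∃ j, before^[j] (root len a.1) = a :=
  ⟨(-a.2).val, by
    obtain ⟨i, b⟩ := a
    change before^[(-b).val] ⟨i, 0⟩ = ⟨i, b⟩
    rw [iterate_before]
    change (⟨i, 0 - ((-b).val : ZMod (len i))⟩ : Pos len) = ⟨i, b⟩
    rw [ZMod.natCast_zmod_val, zero_sub, neg_neg]⟩

/-- The gates of `s` together with those of the cycles of `s'` that do not meet `s`. -/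
def joined {ω : Net n} {H : ℕ} {g : κ → Option (Pos len)} {s s' : Pos len ↪ Fin n}
    (h : Fed ω H s before) (h' : Fed ω H s' before) (hg : Located g s s') :
    Pos len ⊕ OffPos g ↪ Fin n where
  toFun := Sum.elim s fun b => s' b.1
  inj' := by
    -- Going back from a common gate would reach a root of `s'` on `s`, which `g` excludes.
    have key : ∀ (a : Pos len) (b : OffPos g), s a ≠ s' b.1 := by
      intro a b hab
      obtain ⟨j, hj⟩ := exists_iterate_root b.1
      have := h.iterate_eq h' hab j
      rw [hj] at this
      exact (hg b.1.1).2 b.2 _ this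
    rintro (a | a) (b | b) hab
    · exact congrArg Sum.inl (s.injective hab)
    · exact absurd hab (key a b)
    · exact absurd hab.symm (key b a)
    · exact congrArg Sum.inr (Subtype.ext (s'.injective hab))

variable [Fintype κ]

/-- For fixed `g` the joined family determines the pair: a cycle of `s'` that meets `s` is recovered
by going back from the located root. -/
theorem sum_located_le (ω : Net n) (H : ℕ) (g : κ → Option (Pos len)) [Fintype (OffPos g)] :
    ∑ z : (Pos len ↪ Fin n) × (Pos len ↪ Fin n),
      ind (Fed ω H z.1 before ∧ Fed ω H z.2 before ∧ Located g z.1 z.2) ≤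
    ∑ r : Pos len ⊕ OffPos g ↪ Fin n, ind (Fed ω H r (Sum.map before (beforeOff g))) := by
  rw [sum_ind, sum_ind, Nat.cast_le]
  refine Nat.card_le_card_of_injective
    (fun z => ⟨joined z.2.1 z.2.2.1 z.2.2.2, fun a => ?_⟩) ?_
  · rcases a with a | a
    · exact z.2.1 a
    · exact z.2.2.1 a.1
  · rintro ⟨⟨s, s'⟩, h1, h2, h3⟩ ⟨⟨r, r'⟩, k1, k2, k3⟩ heq
    have hfun : ∀ c, joined h1 h2 h3 c = joined k1 k2 k3 c := fun c =>
      congrArg (fun e : Pos len ⊕ OffPos g ↪ Fin n => e c) (Subtype.ext_iff.1 heq)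
    have hs : s = r := by
      ext1 a
      exact hfun (Sum.inl a)
    subst hs
    have hs' : s' = r' := by
      ext1 b
      cases hgb : g b.1 with
      | none => exact hfun (Sum.inr ⟨b, hgb⟩)
      | some a =>
        obtain ⟨j, hj⟩ := exists_iterate_of_root b
        have e1 := h1.iterate_eq h2 ((h3 b.1).1 a hgb) j
        have e2 := h1.iterate_eq k2 ((k3 b.1).1 a hgb) j
        rw [hj] at e1 e2
        exact e1.symm.trans e2
    subst hs'
    rfl

/-- Each pair of families has a locating map `g`; there are (m + 1)^k such maps, and each
contributes at most 1. -/
theorem ex_sq_fed_le [DecidableEq κ] (hp : IsDistribution p) (hs : IsSymmetric p)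
    (hac : probConstant p = probNonCanalyzing p) (hn : 2 ≤ n) (H : ℕ) :
    ex p (fun ω : Net n => (∑ s : Pos len ↪ Fin n, ind (Fed ω H s before)) ^ 2) ≤
      ((Fintype.card (Pos len) : ℝ) + 1) ^ Fintype.card κ := by
  classical
  have h1 : ∀ ω : Net n, (∑ s : Pos len ↪ Fin n, ind (Fed ω H s before)) ^ 2 ≤
      ∑ g : κ → Option (Pos len), ∑ r : Pos len ⊕ OffPos g ↪ Fin n,
        ind (Fed ω H r (Sum.map before (beforeOff g))) := by
    intro ω
    rw [sq, Finset.sum_mul_sum, ← Finset.sum_product', Finset.univ_product_univ]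
    refine le_trans ?_ (Finset.sum_le_sum fun g _ => sum_located_le ω H g)
    rw [Finset.sum_comm]
    refine Finset.sum_le_sum fun z _ => ?_
    obtain ⟨g, hg⟩ := exists_located z.1 z.2
    refine le_trans ?_ (Finset.single_le_sum (f := fun g => ind (Fed ω H z.1 before ∧
      Fed ω H z.2 before ∧ Located g z.1 z.2)) (fun g _ => ind_nonneg _) (Finset.mem_univ g))
    rw [← ind_and]
    exact ind_mono fun h => ⟨h.1, h.2, hg⟩
  refine (ex_mono hp h1).trans ?_
  rw [ex_sum]
  refine (Finset.sum_le_sum fun g _ => ex_sum_fed_le hp hs hac hn _ H).trans ?_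
  rw [Finset.sum_const, Finset.card_univ, nsmul_eq_mul, mul_one, Fintype.card_fun,
    Fintype.card_option]
  push_cast
  exact le_rfl

variable [DecidableEq κ]

theorem Rotating.fed {ω : Net n} {s : Pos len → Fin n} {x : Fin n → Bool} {H : ℕ}
    (h : Rotating ω s x H) : Fed ω H s before :=
  fun a => (h.1 a).mono fun v =>
    (settled_le ω _ x H v).trans (krun_anti ω (Finset.empty_subset _) unknown H v)

/-- A lower bound for the probability that nondegenerate cycles of the lengths `len i` exist. -/
theorem le_ex_exists_rotating (hp : IsDistribution p) (hs : IsSymmetric p)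
    (hac : probConstant p = probNonCanalyzing p) (hn : 2 ≤ n) (x : Fin n → Bool) {H : ℕ} {r : ℝ}
    (hr : 0 ≤ r) (h : ∀ s : Pos len ↪ Fin n,
      r ≤ ex p fun ω => ind (Rotating ω s x H ∧ ∀ i, Nondeg ω s x H i)) :
    (Fintype.card (Pos len ↪ Fin n) * r) ^ 2 /
      ((Fintype.card (Pos len) : ℝ) + 1) ^ Fintype.card κ ≤
    ex p fun ω => ind (∃ s : Pos len ↪ Fin n, Rotating ω s x H ∧ ∀ i, Nondeg ω s x H i) := by
  set N : Net n → ℝ := fun ω => ∑ s : Pos len ↪ Fin n,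
    ind (Rotating ω s x H ∧ ∀ i, Nondeg ω s x H i) with hN
  set c : ℝ := Fintype.card (Pos len ↪ Fin n) * r
  set B : ℝ := ((Fintype.card (Pos len) : ℝ) + 1) ^ Fintype.card κ with hB
  have hB0 : 0 < B := by positivity
  have hc0 : 0 ≤ c := by positivity
  have h1 : c ≤ ex p N := by
    rw [hN, ex_sum]
    refine le_trans (le_of_eq ?_) (Finset.sum_le_sum fun s _ => h s)
    simp [c]
  have hN0 : ∀ ω, 0 ≤ N ω := fun ω => Finset.sum_nonneg fun s _ => ind_nonneg _
  have h2 : ex p (fun ω => N ω ^ 2) ≤ B := by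
    refine le_trans (ex_mono hp fun ω => ?_) (ex_sq_fed_le hp hs hac hn H)
    exact pow_le_pow_left₀ (hN0 ω)
      (Finset.sum_le_sum fun s _ => ind_mono fun h => h.1.fed) 2
  -- Second moment method without division: 2λN - λ²N² is at most 1, and vanishes with N; λ = c/B
  -- maximizes the resulting bound.
  have h3 : ∀ ω, 2 * (c / B) * N ω - (c / B) ^ 2 * N ω ^ 2 ≤
      ind (∃ s : Pos len ↪ Fin n, Rotating ω s x H ∧ ∀ i, Nondeg ω s x H i) := by
    intro ω
    by_cases he : ∃ s : Pos len ↪ Fin n, Rotating ω s x H ∧ ∀ i, Nondeg ω s x H i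
    · rw [ind_pos he]
      nlinarith [sq_nonneg (c / B * N ω - 1)]
    · rw [ind_neg he]
      have : N ω = 0 := Finset.sum_eq_zero fun s _ => ind_neg fun h => he ⟨s, h⟩
      rw [this]; simp
  refine le_trans ?_ (ex_mono hp h3)
  rw [ex_sub, ex_mul_left, ex_mul_left]
  have h4 : 2 * (c / B) * c ≤ 2 * (c / B) * ex p N := mul_le_mul_of_nonneg_left h1 (by positivity)
  have h5 : (c / B) ^ 2 * ex p (fun ω => N ω ^ 2) ≤ (c / B) ^ 2 * B :=
    mul_le_mul_of_nonneg_left h2 (by positivity)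
  have h6 : 2 * (c / B) * c - (c / B) ^ 2 * B = c ^ 2 / B := by field_simp; ring
  linarith

end Cycles

end RBCA

namespace RBCA

variable {p : BoolFn → ℝ} {n : ℕ}

/-! ### Cycles of prescribed prime lengths -/

theorem exp_neg_two_mul_le {y : ℝ} (h0 : 0 ≤ y) (h1 : y ≤ 1 / 2) :
    Real.exp (-(2 * y)) ≤ 1 - y := by
  rw [Real.exp_neg, inv_le_comm₀ (Real.exp_pos _) (by linarith)]
  refine le_trans ?_ (Real.add_one_le_exp (2 * y))
  rw [inv_le_iff_one_le_mul₀ (by linarith)]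
  nlinarith

theorem half_pow_le_card_embedding {ι : Type*} [Fintype ι] (hn : 2 * Fintype.card ι ^ 2 ≤ n)
    (hn0 : 0 < n) : (n : ℝ) ^ Fintype.card ι / 2 ≤ Fintype.card (ι ↪ Fin n) := by
  rw [Fintype.card_embedding_eq, Fintype.card_fin]
  set m := Fintype.card ι
  have hmn : m ≤ n := by nlinarith
  have hn' : (0 : ℝ) < n := by exact_mod_cast hn0
  have h1 : (n - m) ^ m ≤ n.descFactorial m :=
    (Nat.pow_le_pow_left (by omega) m).trans (Nat.pow_sub_le_descFactorial n m)
  have h2 : ((n : ℝ) - m) ^ m ≤ n.descFactorial m := by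
    rw [← Nat.cast_sub hmn]; exact_mod_cast h1
  refine le_trans ?_ h2
  have hmn' : (m : ℝ) / n ≤ 1 := (div_le_one hn').2 (by exact_mod_cast hmn)
  have h3 := one_add_mul_le_pow (a := -((m : ℝ) / n)) (by linarith) m
  have h4 : (m : ℝ) * ((m : ℝ) / n) ≤ 1 / 2 := by
    rw [← mul_div_assoc, div_le_iff₀ hn']
    have : (2 * m ^ 2 : ℝ) ≤ n := by exact_mod_cast hn
    nlinarith
  have h5 : (1 : ℝ) / 2 ≤ (1 + -((m : ℝ) / n)) ^ m := by linarith
  have h6 : (n : ℝ) - m = n * (1 + -((m : ℝ) / n)) := by field_simp; ring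
  rw [h6, mul_pow, div_eq_mul_one_div]
  exact mul_le_mul_of_nonneg_left h5 (by positivity)

theorem card_pos_eq {κ : Type*} [Fintype κ] (len : κ → ℕ) [∀ i, NeZero (len i)] :
    Fintype.card (Pos len) = ∑ i, len i := by
  simp [Pos, Fintype.card_sigma, ZMod.card]

theorem exists_le_ex_dvd (hp : IsDistribution p) (hs : IsSymmetric p)
    (hac : probConstant p = probNonCanalyzing p) (hne : probConstant p ≠ 0) (k : ℕ) :
    ∃ c₁ : ℝ, 0 < c₁ ∧ ∃ L₀ : ℕ, ∀ L, L₀ ≤ L → ∀ n : ℕ, L ^ 5 ≤ n → ∀ (x : Fin n → Bool)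
      (S : Finset ℕ), (∀ ℓ ∈ S, ℓ.Prime ∧ L < ℓ ∧ ℓ ≤ 8 * L) → S.card = k →
      c₁ / (L : ℝ) ^ k ≤ ex p fun ω => ind (∀ ℓ ∈ S, ℓ ∣ (aut ω x).cycleSize) := by
  have hc0 : 0 < probNonCanalyzing p :=
    lt_of_le_of_ne (probNonCanalyzing_nonneg hp) (hac ▸ hne.symm)
  set c := probNonCanalyzing p with hc
  -- 1/c comes from the decay of the undetermined fraction, 16k + 4 from the clamping errors, which
  -- are small because L^5 ≤ n.
  set K : ℝ := 1 / c + 16 * k + 4 with hK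
  have hK0 : 0 < K := by positivity
  set c₀ : ℝ := (2 * c) ^ k * Real.exp (-(16 * k * K)) / 2 ^ k / 2 with hc₀
  have hc₀0 : 0 < c₀ := by positivity
  refine ⟨c₀ ^ 2 / (8 * k + 1) ^ k, by positivity, ⌈2 * K⌉₊ + 128 * k ^ 2 + 2, ?_⟩
  intro L hL n hn x S hS hSk
  have hLK : 2 * K ≤ L := (Nat.le_ceil _).trans (by exact_mod_cast (by omega))
  have hL2 : 2 ≤ L := by omega
  have hLr : (2 : ℝ) ≤ L := by exact_mod_cast hL2
  have hL0 : (0 : ℝ) < L := by linarith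
  have hLn : L ≤ n := (Nat.le_self_pow (by norm_num) L).trans hn
  have hn2 : 2 ≤ n := hL2.trans hLn
  have hnr : (L : ℝ) ^ 5 ≤ n := by exact_mod_cast hn
  have hn0 : (0 : ℝ) < n := by have : (2 : ℝ) ≤ n := by exact_mod_cast hn2
                               linarith
  let len : S → ℕ := fun ℓ => ℓ.1
  have : ∀ i, NeZero (len i) := fun i => ⟨(hS i.1 i.2).1.ne_zero⟩
  set m := Fintype.card (Pos len) with hm
  have hcardS : Fintype.card S = k := by rw [Fintype.card_coe, hSk]
  have hmle : m ≤ 8 * k * L := by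
    rw [hm, card_pos_eq]
    refine (Finset.sum_le_card_nsmul Finset.univ len (8 * L) fun i _ => (hS i.1 i.2).2.2).trans ?_
    rw [Finset.card_univ, hcardS, smul_eq_mul]
    exact le_of_eq (by ring)
  have hmr : (m : ℝ) ≤ 8 * k * L := by exact_mod_cast hmle
  -- the expected fraction of gates that are not settled
  have hX : ∀ s : Pos len ↪ Fin n, ex p (fun ω => unk (settled ω (gates s) x L)) / n ≤ K / L := by
    intro s
    refine (ex_unk_settled_le hp hs hac hne hn2 x L (gates s)).trans ?_
    rw [← hc]
    have hZ : ((gates s).card : ℝ) ≤ 8 * k * L :=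
      (by exact_mod_cast card_gates_le s : ((gates s).card : ℝ) ≤ m).trans hmr
    have e1 : 1 / (c * (L + 2)) ≤ 1 / c / L := by
      rw [div_div]
      exact one_div_le_one_div_of_le (by positivity)
        (mul_le_mul_of_nonneg_left (by linarith) hc0.le)
    have e2 : (((gates s).card + L : ℕ) + 1 : ℝ) ≤ (8 * k + 2) * L := by
      push_cast; linarith
    have e3 : (((gates s).card + L : ℕ) + 1 : ℝ) / n ≤ (8 * k + 2) * L / L ^ 5 :=
      div_le_div₀ (by positivity) e2 (by positivity) hnr
    have e4 : (L + L ^ 2 : ℝ) ≤ 2 * L ^ 2 := by nlinarith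
    have e5 : (L + L ^ 2 : ℝ) * ((((gates s).card + L : ℕ) + 1 : ℝ) / n) ≤
        2 * L ^ 2 * ((8 * k + 2) * L / L ^ 5) :=
      mul_le_mul e4 e3 (by positivity) (by positivity)
    have e6 : 2 * (L : ℝ) ^ 2 * ((8 * k + 2) * L / L ^ 5) = (16 * k + 4) / L / L := by
      field_simp; ring
    have e7 : (16 * k + 4 : ℝ) / L / L ≤ (16 * k + 4) / L :=
      div_le_self (by positivity) (by linarith)
    have e8 : K / L = 1 / c / L + (16 * k + 4) / L := by rw [hK]; ring
    linarith
  have hKL : K / L ≤ 1 / 2 := by rw [div_le_iff₀ hL0]; linarith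
  -- The cycles have m = O(L) gates and the defect is O(1/L), so the bound does not depend on `L`.
  have hpow : Real.exp (-(16 * k * K)) ≤ (1 - K / L) ^ m := by
    refine le_trans ?_ (pow_le_pow_left₀ (Real.exp_pos _).le
      (exp_neg_two_mul_le (by positivity) hKL) m)
    rw [← Real.exp_nat_mul, Real.exp_le_exp]
    have : (m : ℝ) * (2 * (K / L)) ≤ 8 * k * L * (2 * (K / L)) :=
      mul_le_mul_of_nonneg_right hmr (by positivity)
    have h2 : 8 * k * L * (2 * (K / L)) = 16 * k * K := by field_simp; ring
    linarith
  set r : ℝ := (2 * c) ^ k * ((1 / (n : ℝ)) ^ m * Real.exp (-(16 * k * K))) / 2 ^ k with hr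
  have hr0 : 0 ≤ r := by positivity
  have hlow : ∀ s : Pos len ↪ Fin n,
      r ≤ ex p fun ω => ind (Rotating ω s x L ∧ ∀ i, Nondeg ω s x L i) := by
    intro s
    have h1 := le_ex_wired_settled hp hs hac hn2 s.injective before (roots len) x L (hX s)
      (by linarith)
    have h2 := ex_rotating_le hp hs s.injective x (H := L) (by omega)
      (fun i => (hS i.1 i.2).2.1)
    rw [card_roots, hcardS] at h1
    rw [hcardS] at h2
    rw [hr, div_le_iff₀ (by positivity), mul_comm _ ((2 : ℝ) ^ k)]
    refine le_trans ?_ (h1.trans h2)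
    refine mul_le_mul_of_nonneg_left ?_ (by positivity)
    exact mul_le_mul_of_nonneg_left hpow (by positivity)
  have hmain := le_ex_exists_rotating hp hs hac hn2 x hr0 hlow
  rw [hcardS, ← hm] at hmain
  have hemb : (n : ℝ) ^ m / 2 ≤ Fintype.card (Pos len ↪ Fin n) := by
    refine half_pow_le_card_embedding ?_ (by omega)
    have hk : 128 * k ^ 2 ≤ L := by omega
    calc 2 * Fintype.card (Pos len) ^ 2 ≤ 2 * (8 * k * L) ^ 2 :=
          Nat.mul_le_mul_left 2 (Nat.pow_le_pow_left hmle 2)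
      _ = 128 * k ^ 2 * L ^ 2 := by ring
      _ ≤ L * L ^ 2 := Nat.mul_le_mul_right _ hk
      _ = L ^ 3 := by ring
      _ ≤ L ^ 5 := Nat.pow_le_pow_right (by omega) (by norm_num)
      _ ≤ n := hn
  have hcr : c₀ ≤ Fintype.card (Pos len ↪ Fin n) * r := by
    refine le_trans (le_of_eq ?_) (mul_le_mul_of_nonneg_right hemb hr0)
    rw [hr, hc₀, one_div, inv_pow]
    field_simp
  have hB : ((m : ℝ) + 1) ^ k ≤ ((8 * k + 1) * L) ^ k :=
    pow_le_pow_left₀ (by positivity) (by linarith) k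
  calc c₀ ^ 2 / (8 * k + 1) ^ k / (L : ℝ) ^ k = c₀ ^ 2 / ((8 * k + 1) * L) ^ k := by
        rw [div_div, mul_pow]
    _ ≤ (Fintype.card (Pos len ↪ Fin n) * r) ^ 2 / ((m : ℝ) + 1) ^ k :=
        div_le_div₀ (by positivity) (pow_le_pow_left₀ hc₀0.le hcr 2) (by positivity) hB
    _ ≤ _ := hmain
    _ ≤ _ := by
        refine ex_mono hp fun ω => ind_mono ?_
        rintro ⟨s, hR, hN⟩ ℓ hℓ
        have hprime := (hS ℓ hℓ).1
        have hlt := (hS ℓ hℓ).2.1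
        exact hR.dvd_cycleSize (hN ⟨ℓ, hℓ⟩) hprime (hprime.odd_of_ne_two (by omega))

end RBCA

namespace RBCA

variable {p : BoolFn → ℝ} {n : ℕ}

/-! ### Many primes -/

/-- The primes in the interval `(L, 8 * L]`. -/
def primesBetween (L : ℕ) : Finset ℕ := (Finset.Ioc L (8 * L)).filter Nat.Prime

theorem mem_primesBetween {L ℓ : ℕ} (h : ℓ ∈ primesBetween L) :
    ℓ.Prime ∧ L < ℓ ∧ ℓ ≤ 8 * L := by
  simp only [primesBetween, Finset.mem_filter, Finset.mem_Ioc] at h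
  exact ⟨h.2, h.1⟩

theorem theta_sub_le (L : ℕ) : Chebyshev.theta (8 * L : ℕ) - Chebyshev.theta L ≤
    (primesBetween L).card * Real.log (8 * L) := by
  have h : Chebyshev.theta (8 * L : ℕ) =
      Chebyshev.theta L + ∑ ℓ ∈ primesBetween L, Real.log ℓ := by
    unfold Chebyshev.theta primesBetween
    rw [Nat.floor_natCast, Nat.floor_natCast, Finset.sum_filter, Finset.sum_filter,
      Finset.sum_filter, Finset.sum_Ioc_consecutive _ (Nat.zero_le L) (by omega)]
  rw [h, add_sub_cancel_left, ← nsmul_eq_mul]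
  refine Finset.sum_le_card_nsmul _ _ _ fun ℓ hℓ => ?_
  obtain ⟨h1, h2, h3⟩ := mem_primesBetween hℓ
  exact Real.log_le_log (by exact_mod_cast h1.pos) (by exact_mod_cast h3)

/-- The factor 8 leaves room: θ(8L) is at least about 8L log 2 and θ(L) at most 2L log 2. With u =
L^(1/4) the logarithms are at most 8u, so elementary bounds suffice. -/
theorem sqrt_le_card_primesBetween {L : ℕ} (hL : 100000 ≤ L) :
    √(L : ℝ) ≤ (primesBetween L).card := by
  have hLr : (100000 : ℝ) ≤ L := by exact_mod_cast hL
  have hL0 : (0 : ℝ) ≤ L := by linarith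
  set u : ℝ := √(√(L : ℝ)) with hu
  have hu0 : 0 ≤ u := Real.sqrt_nonneg _
  have hu2 : u ^ 2 = √(L : ℝ) := Real.sq_sqrt (Real.sqrt_nonneg _)
  have hu4 : u ^ 4 = L := by
    have : u ^ 4 = (u ^ 2) ^ 2 := by ring
    rw [this, hu2, Real.sq_sqrt hL0]
  have hu17 : 17.5 ≤ u := by
    by_contra! h
    have : u ^ 4 < 17.5 ^ 4 := pow_lt_pow_left₀ h hu0 (by norm_num)
    rw [hu4] at this
    norm_num at this
    linarith
  have hlog : Real.log (8 * L + 1) ≤ 8 * u := by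
    have h1 : Real.log (8 * L + 1) ≤ Real.log ((2 * u) ^ 4) :=
      Real.log_le_log (by linarith) (by rw [mul_pow, hu4]; norm_num; linarith)
    rw [Real.log_pow] at h1
    have h2 := Real.log_le_sub_one_of_pos (show 0 < 2 * u by linarith)
    push_cast at h1
    linarith
  have hlog' : Real.log (8 * L) ≤ 8 * u :=
    (Real.log_le_log (by linarith) (by linarith)).trans hlog
  have hsqrt : √(8 * L : ℝ) ≤ 3 * u ^ 2 := by
    rw [hu2, Real.sqrt_le_left (by positivity), mul_pow, Real.sq_sqrt hL0]
    linarith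
  have h1 := Chebyshev.theta_ge (8 * L)
  have h2 := Chebyshev.theta_le_log4_mul_x hL0
  have h3 := theta_sub_le L
  push_cast at h1 h3
  have h4 : Real.log 4 = 2 * Real.log 2 := by
    rw [show (4 : ℝ) = 2 ^ 2 by norm_num, Real.log_pow]; norm_num
  rw [h4] at h2
  have h5 := Real.log_two_gt_d9
  have h6 : 2 * √(8 * L : ℝ) * Real.log (8 * L) ≤ 2 * (3 * u ^ 2) * (8 * u) := by
    have : 0 ≤ Real.log (8 * L) := Real.log_nonneg (by linarith)
    gcongr
  have h7 : ((primesBetween L).card : ℝ) * Real.log (8 * L) ≤ (primesBetween L).card * (8 * u) :=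
    mul_le_mul_of_nonneg_left hlog' (by positivity)
  have h8 : 6 * Real.log 2 * L ≤ (primesBetween L).card * (8 * u) + 8 * u + 48 * u ^ 3 := by
    nlinarith
  have h9 : 4 * u ^ 4 ≤ (primesBetween L).card * (8 * u) + 8 * u + 48 * u ^ 3 := by
    rw [hu4]; nlinarith
  rw [← hu2]
  have h10 : u ^ 2 * (8 * u) ≤ (primesBetween L).card * (8 * u) := by
    nlinarith [mul_nonneg hu0 hu0, mul_nonneg (mul_nonneg hu0 hu0) hu0,
      mul_nonneg (mul_nonneg (mul_nonneg hu0 hu0) hu0) (sub_nonneg.2 hu17),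
      mul_nonneg hu0 (sub_nonneg.2 hu17), mul_nonneg (mul_nonneg hu0 hu0) (sub_nonneg.2 hu17)]
  exact le_of_mul_le_mul_right h10 (by linarith)

/-! ### The expected size of the state cycle -/

/-- With j primes of `P` dividing `C`, the left side is one term of the binomial expansion of (L +
1)^j, which is at most their product. No independence between different sets of primes is needed. -/
theorem choose_mul_le_cycleSize {C L k : ℕ} (hC : 0 < C) (P : Finset ℕ)
    (hP : ∀ ℓ ∈ P, ℓ.Prime ∧ L < ℓ) :
    ∑ S ∈ P.powersetCard k, ind (∀ ℓ ∈ S, ℓ ∣ C) * (L : ℝ) ^ k ≤ C := by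
  classical
  set J := P.filter (· ∣ C) with hJ
  have h1 : ∑ S ∈ P.powersetCard k, ind (∀ ℓ ∈ S, ℓ ∣ C) = J.card.choose k := by
    simp only [ind_eq_ite]
    rw [Finset.sum_boole, ← Finset.card_powersetCard]
    congr 2
    ext S
    simp only [Finset.mem_filter, Finset.mem_powersetCard, hJ, Finset.subset_iff]
    constructor
    · rintro ⟨⟨h1, h2⟩, h3⟩; exact ⟨fun ℓ hℓ => ⟨h1 hℓ, h3 ℓ hℓ⟩, h2⟩
    · rintro ⟨h1, h2⟩; exact ⟨⟨fun ℓ hℓ => (h1 hℓ).1, h2⟩, fun ℓ hℓ => (h1 hℓ).2⟩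
  rw [← Finset.sum_mul, h1]
  have h2 : ∏ ℓ ∈ J, ℓ ≤ C := by
    refine Nat.le_of_dvd hC (Finset.prod_primes_dvd C (fun ℓ hℓ => ?_) fun ℓ hℓ => ?_)
    · exact (hP ℓ (Finset.mem_filter.1 hℓ).1).1.prime
    · exact (Finset.mem_filter.1 hℓ).2
  have h3 : (L + 1) ^ J.card ≤ ∏ ℓ ∈ J, ℓ := by
    rw [← Finset.prod_const]
    exact Finset.prod_le_prod' fun ℓ hℓ => (hP ℓ (Finset.mem_filter.1 hℓ).1).2
  have h4 : J.card.choose k * L ^ k ≤ (L + 1) ^ J.card := by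
    rcases lt_or_ge J.card k with hk | hk
    · rw [Nat.choose_eq_zero_of_lt hk]; simp
    · rw [add_pow]
      refine le_trans (le_of_eq ?_) (Finset.single_le_sum
        (f := fun m => L ^ m * 1 ^ (J.card - m) * J.card.choose m) (fun _ _ => Nat.zero_le _)
        (Finset.mem_range.2 (Nat.lt_succ_of_le hk)))
      simp [mul_comm]
  exact_mod_cast h4.trans (h3.trans h2)

theorem expectation_eq (X : Automaton n → ℝ) :
    expectation p n X = ∑ x : Fin n → Bool, 1 / 2 ^ n * ex p fun ω => X (aut ω x) := by
  have h : ∀ x : Fin n → Bool, 1 / 2 ^ n * ex p (fun ω => X (aut ω x)) =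
      ∑ D : Fin n → InputPair n, ∑ F : Fin n → BoolFn, prob p ⟨D, F, x⟩ * X ⟨D, F, x⟩ := by
    intro x
    rw [ex, ← Fintype.sum_prod_type', Finset.mul_sum,
      ← Equiv.sum_comp (Equiv.arrowProdEquivProdArrow (Fin n) (fun _ => InputPair n)
        (fun _ => BoolFn))]
    refine Finset.sum_congr rfl fun ω _ => ?_
    simp only [prob, gateWeight, Finset.prod_mul_distrib, aut, Equiv.arrowProdEquivProdArrow,
      Equiv.coe_fn_mk]
    ring
  rw [Finset.sum_congr rfl fun x _ => h x, expectation,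
    Finset.sum_comm (s := Finset.univ (α := Fin n → Bool))]
  exact Finset.sum_congr rfl fun D _ => Finset.sum_comm

theorem le_expectation {X : Automaton n → ℝ} {r : ℝ}
    (h : ∀ x : Fin n → Bool, r ≤ ex p fun ω => X (aut ω x)) : r ≤ expectation p n X := by
  rw [expectation_eq]
  refine le_trans (le_of_eq ?_)
    (Finset.sum_le_sum fun x _ => mul_le_mul_of_nonneg_left (h x) (by positivity))
  simp

theorem exists_choose_le_expectation (hp : IsDistribution p) (hs : IsSymmetric p)
    (hac : probConstant p = probNonCanalyzing p) (hne : probConstant p ≠ 0) (k : ℕ) :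
    ∃ c₁ : ℝ, 0 < c₁ ∧ ∃ L₀ : ℕ, ∀ L, L₀ ≤ L → ∀ n : ℕ, L ^ 5 ≤ n →
      c₁ * (primesBetween L).card.choose k ≤ expectation p n fun B => (B.cycleSize : ℝ) := by
  obtain ⟨c₁, hc₁, L₀, h⟩ := exists_le_ex_dvd hp hs hac hne k
  refine ⟨c₁, hc₁, L₀ + 1, fun L hL n hn => le_expectation fun x => ?_⟩
  have hL0 : (0 : ℝ) < L := by exact_mod_cast (by omega : 0 < L)
  have h1 : ∀ ω : Net n, ∑ S ∈ (primesBetween L).powersetCard k,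
      ind (∀ ℓ ∈ S, ℓ ∣ (aut ω x).cycleSize) * (L : ℝ) ^ k ≤ (aut ω x).cycleSize := by
    intro ω
    obtain ⟨_, hpos, _⟩ := (aut ω x).cycleSize_spec
    exact choose_mul_le_cycleSize hpos _ fun ℓ hℓ =>
      ⟨(mem_primesBetween hℓ).1, (mem_primesBetween hℓ).2.1⟩
  refine le_trans ?_ (ex_mono hp h1)
  rw [ex_sum]
  have h2 : ∀ S ∈ (primesBetween L).powersetCard k, c₁ ≤ ex p fun ω : Net n =>
      ind (∀ ℓ ∈ S, ℓ ∣ (aut ω x).cycleSize) * (L : ℝ) ^ k := by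
    intro S hS
    obtain ⟨hS1, hS2⟩ := Finset.mem_powersetCard.1 hS
    have := h L (by omega) n hn x S (fun ℓ hℓ => mem_primesBetween (hS1 hℓ)) hS2
    rw [div_le_iff₀ (by positivity)] at this
    refine this.trans (le_of_eq ?_)
    rw [mul_comm, ← ex_mul_left]
    congr 1; funext ω; ring
  refine le_trans (le_of_eq ?_) (Finset.sum_le_sum h2)
  rw [Finset.sum_const, Finset.card_powersetCard, nsmul_eq_mul, mul_comm]

/-! ### Choice of the parameters -/

/-- The integral part of the fifth root of `n`. -/
noncomputable def fifthRoot (n : ℕ) : ℕ := ⌊(n : ℝ) ^ (1 / 5 : ℝ)⌋₊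

theorem fifthRoot_pow_le (n : ℕ) : fifthRoot n ^ 5 ≤ n := by
  have h : (fifthRoot n : ℝ) ≤ (n : ℝ) ^ (1 / 5 : ℝ) := Nat.floor_le (by positivity)
  have h2 : (fifthRoot n : ℝ) ^ 5 ≤ ((n : ℝ) ^ (1 / 5 : ℝ)) ^ 5 :=
    pow_le_pow_left₀ (by positivity) h 5
  rw [← Real.rpow_natCast, ← Real.rpow_natCast, ← Real.rpow_mul (by positivity)] at h2
  norm_num at h2
  exact_mod_cast h2

theorem lt_succ_fifthRoot_pow (n : ℕ) : n < (fifthRoot n + 1) ^ 5 := by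
  have h : (n : ℝ) ^ (1 / 5 : ℝ) < (fifthRoot n : ℝ) + 1 := Nat.lt_floor_add_one _
  have h2 : ((n : ℝ) ^ (1 / 5 : ℝ)) ^ 5 < ((fifthRoot n : ℝ) + 1) ^ 5 :=
    pow_lt_pow_left₀ h (by positivity) (by norm_num)
  rw [← Real.rpow_natCast, ← Real.rpow_mul (by positivity)] at h2
  norm_num at h2
  exact_mod_cast h2

theorem tendsto_fifthRoot : Tendsto fifthRoot atTop atTop :=
  tendsto_nat_floor_atTop.comp
    ((tendsto_rpow_atTop (by norm_num)).comp tendsto_natCast_atTop_atTop)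

end RBCA

open RBCA in
theorem theorem4p1 (p : RBCA.BoolFn → ℝ) (hp : RBCA.IsDistribution p)
    (hsymm : RBCA.IsSymmetric p)
    (hac : RBCA.probConstant p = RBCA.probNonCanalyzing p)
    (hne : RBCA.probConstant p ≠ 0) (γ : ℝ) :
    ∀ᶠ n : ℕ in atTop,
      (n : ℝ) ^ γ < RBCA.expectation p n (fun B => (B.cycleSize : ℝ)) := by
  obtain ⟨g, hg⟩ := exists_nat_ge γ
  -- Then √L^k = L^(5g + 1), one factor L more than n^γ ≤ 32^g L^(5g); this factor beats the
  -- constant `D`.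
  set k := 10 * g + 2 with hk
  obtain ⟨c₁, hc₁, L₀, h⟩ := exists_choose_le_expectation hp hsymm hac hne k
  set D : ℝ := 32 ^ g * (2 ^ k * k.factorial) / c₁ with hD
  filter_upwards [tendsto_fifthRoot.eventually_ge_atTop
    (L₀ + 100000 + (2 * k) ^ 2 + ⌈D⌉₊ + 1)] with n hn
  set L := fifthRoot n with hL
  have hLr : (1 : ℝ) ≤ L := by exact_mod_cast (by omega : 1 ≤ L)
  have hexp := h L (by omega) n (fifthRoot_pow_le n)
  refine lt_of_lt_of_le ?_ hexp
  have hn1 : 1 ≤ n := le_trans (Nat.one_le_pow 5 L (by omega)) (fifthRoot_pow_le n)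
  have h1 : (n : ℝ) ^ γ ≤ 32 ^ g * (L : ℝ) ^ (5 * g) := by
    have e1 : (n : ℝ) ^ γ ≤ (n : ℝ) ^ (g : ℝ) :=
      Real.rpow_le_rpow_of_exponent_le (by exact_mod_cast hn1) hg
    rw [Real.rpow_natCast] at e1
    have e2 : n ≤ 32 * L ^ 5 := by
      have h5 : n < (L + 1) ^ 5 := lt_succ_fifthRoot_pow n
      have h6 : (L + 1) ^ 5 ≤ (2 * L) ^ 5 := Nat.pow_le_pow_left (by omega) 5
      have h7 : (2 * L) ^ 5 = 32 * L ^ 5 := by ring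
      omega
    have e3 : (n : ℝ) ≤ 32 * (L : ℝ) ^ 5 := by exact_mod_cast e2
    refine e1.trans ((pow_le_pow_left₀ (by positivity) e3 g).trans (le_of_eq ?_))
    rw [mul_pow, ← pow_mul]
  have hsq := sqrt_le_card_primesBetween (L := L) (by omega)
  have h2 : (√(L : ℝ) / 2) ^ k / k.factorial ≤ ((primesBetween L).card.choose k : ℝ) := by
    refine le_trans ?_ (Nat.pow_le_choose k _)
    refine div_le_div_of_nonneg_right (pow_le_pow_left₀ (by positivity) ?_ k) (by positivity)
    have e1 : (2 * k : ℝ) ≤ √(L : ℝ) := by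
      refine Real.le_sqrt_of_sq_le ?_
      exact_mod_cast (by omega : (2 * k) ^ 2 ≤ L)
    have e2 : ((primesBetween L).card : ℝ) - k ≤ (((primesBetween L).card + 1 - k : ℕ) : ℝ) := by
      have : (primesBetween L).card ≤ ((primesBetween L).card + 1 - k) + k := by omega
      have : ((primesBetween L).card : ℝ) ≤ (((primesBetween L).card + 1 - k : ℕ) : ℝ) + k := by
        exact_mod_cast this
      linarith
    linarith
  have h3 : √(L : ℝ) ^ k = (L : ℝ) ^ (5 * g) * L := by
    have : k = 2 * (5 * g + 1) := by omega
    rw [this, pow_mul, Real.sq_sqrt (by linarith), pow_succ]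
  have h4 : D < L := lt_of_le_of_lt (Nat.le_ceil D) (by exact_mod_cast (by omega : ⌈D⌉₊ < L))
  have h5 : 32 ^ g * (2 ^ k * k.factorial) < L * c₁ := by
    rwa [hD, div_lt_iff₀ hc₁] at h4
  calc (n : ℝ) ^ γ ≤ 32 ^ g * (L : ℝ) ^ (5 * g) := h1
    _ < c₁ * ((√(L : ℝ) / 2) ^ k / k.factorial) := by
        rw [div_pow, h3, div_div, ← mul_div_assoc, lt_div_iff₀ (by positivity)]
        have hpos : (0 : ℝ) < (L : ℝ) ^ (5 * g) := by positivity
        nlinarith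
    _ ≤ _ := mul_le_mul_of_nonneg_left h2 hc₁.le
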